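/- Let $\mathbf k$ be a field and let $\mathcal D$ be a $\mathbf k$-linear triangulated category which is saturated (it admits a smooth and proper dg-enhancement) and of finite type ($\bigoplus_{j\in\mathbb Z}\operatorname{Hom}(X,Y[j])$ is finite-dimensional over $\mathbf k$ for all $X,Y$). For objects $G,E$ of $\mathcal D$ and $t\in\mathbb R$ let $$\delta_t(G,E)=\inf\Big\{\sum_{\ell=1}^m e^{k_\ell t}\Big\}\in[0,\infty],$$ the infimum being over all sequences $0=A_0\to A_1\to\cdots\to A_m\cong E\oplus E'$ (with $E'$ any object) such that $\operatorname{Cone}(A_{\ell-1}\to A_\ell)\cong G[k_\ell]$ for all $\ell$. An object $G$ is a split generator if $\delta_t(G,E)<\infty$ for all $E$ and $t$; assume that $\mathcal D$ has a split generator. Let $F\colon\mathcal D\to\mathcal D$ be a $\mathbf k$-linear triangulated endofunctor no power of which is the zero functor. A full additive subcategory $\mathcal A\subseteq\mathcal D$ (closed under isomorphisms) is the heart of a bounded t-structure if $\operatorname{Hom}(A_1[k_1],A_2[k_2])=0$ for all $A_1,A_2\in\mathcal A$ and $k_1>k_2$, and every nonzero $E\in\mathcal D$ has a (necessarily unique)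 filtration $0=E_0\to E_1\to\cdots\to E_m=E$ with exact triangles $E_{\ell-1}\to E_\ell\to A_\ell[k_\ell]\to E_{\ell-1}[1]$, where $0\neq A_\ell\in\mathcal A$ and $k_1>\cdots>k_m$. Put $\phi^+_{\mathcal A}(E)=k_1$ and $\phi^-_{\mathcal A}(E)=k_m$. The upper and lower shifting numbers of $F$ are $\tau^{\pm}(F)=\lim_{t\to\pm\infty}h_t(F)/t$, where $h_t(F)=\lim_{n\to\infty}\frac1n\log\delta_t(G,F^nG)$, which does not depend on the split generator $G$. Then: 1. The number $\tau^+(F)\in\mathbb R$ is well defined (the limits defining it exist, $h_t(F)$ is real and independent of the split generator), and for every split generator $G$ and every heart $\mathcal A$ of a bounded t-structure on $\mathcal D$ the following limit exists and $$\lim_{n\to\infty}\frac{\phi^+_{\mathcal A}(F^nG)}{n}=\tau^+(F).$$ In particular it is independent of $G$ and $\mathcal A$. 2. If $\mathcal D$ admits a Serre functor, then likewise $\tau^-(F)\in\mathbb R$ is well defined, and for every split generator $G$ and every heart $\mathcal A$ of a bounded t-structure on $\mathcal D$ the following limit exists and $$\lim_{n\to\infty}\frac{\phi^-_{\mathcal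 A}(F^nG)}{n}=\tau^-(F).$$ In particular it is independent of $G$ and $\mathcal A$. -/

import Mathlib

universe w v u uk

open CategoryTheory CategoryTheory.Limits CategoryTheory.Pretriangulated Filter Topology
open scoped TensorProduct DirectSum ENNReal

noncomputable section

namespace ShiftingNumbers

/-! ## Dg categories and dg bimodules -/

/-- A dg category over `k`. The underlying category `B` has as morphisms `X ⟶ Y` the elements of
the total Hom space `⨁ n, Hom(X, Y)ⁿ`; `deg X Y n` is the homogeneous part of degree `n`, and
`d` is the differential. The last axiom is the Leibniz rule
`d (g ∘ f) = d g ∘ f + (-1)^|g| g ∘ d f`. -/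
class DGCategory (k : Type uk) [Field k] (B : Type w) [Category.{w} B] [Preadditive B]
    [Linear k B] where
  deg (X Y : B) (n : ℤ) : Submodule k (X ⟶ Y)
  isInternal (X Y : B) : DirectSum.IsInternal (deg X Y)
  id_mem (X : B) : 𝟙 X ∈ deg X X 0
  comp_mem {X Y Z : B} {p q : ℤ} {f : X ⟶ Y} {g : Y ⟶ Z} (hf : f ∈ deg X Y p)
    (hg : g ∈ deg Y Z q) : f ≫ g ∈ deg X Z (p + q)
  d (X Y : B) : (X ⟶ Y) →ₗ[k] (X ⟶ Y)
  d_mem {X Y : B} {n : ℤ} {f : X ⟶ Y} (hf : f ∈ deg X Y n) : d X Y f ∈ deg X Y (n + 1)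
  d_d {X Y : B} (f : X ⟶ Y) : d X Y (d X Y f) = 0
  d_comp {X Y Z : B} {q : ℤ} (f : X ⟶ Y) {g : Y ⟶ Z} (hg : g ∈ deg Y Z q) :
    d X Z (f ≫ g) = f ≫ d Y Z g + ((q.negOnePow : ℤˣ) : ℤ) • (d X Y f ≫ g)

section DG

/-- The homotopy category `H⁰(B)` of a dg category: same objects as `B`, and morphisms
the closed morphisms of degree `0` modulo the exact ones. -/
structure H0 (k : Type uk) (B : Type w) where
  of : B

variable (k : Type uk) [Field k] (B : Type w) [Category.{w} B] [Preadditive B]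
    [Linear k B] [DGCategory k B]

variable {B} in
/-- Closed morphisms of degree `0`. -/
def Z0 (X Y : B) : Submodule k (X ⟶ Y) :=
  DGCategory.deg (k := k) X Y 0 ⊓ LinearMap.ker (DGCategory.d (k := k) X Y)

variable {B} in
/-- The exact morphisms of degree `0`, as a subspace of the closed ones. -/
def B0 (X Y : B) : Submodule k (Z0 k X Y) :=
  (LinearMap.range (DGCategory.d (k := k) X Y)).submoduleOf (Z0 k X Y)

variable {B} in
lemma d_id (X : B) : DGCategory.d (k := k) X X (𝟙 X) = 0 := by
  have h := DGCategory.d_comp (k := k) (𝟙 X) (DGCategory.id_mem (k := k) X)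
  simpa using h

variable {B} in
lemma comp_mem_Z0 {X Y Z : B} {f : X ⟶ Y} {g : Y ⟶ Z} (hf : f ∈ Z0 k X Y) (hg : g ∈ Z0 k Y Z) :
    f ≫ g ∈ Z0 k X Z := by
  refine ⟨by simpa using DGCategory.comp_mem hf.1 hg.1, ?_⟩
  have h1 : DGCategory.d (k := k) X Y f = 0 := hf.2
  have h2 : DGCategory.d (k := k) Y Z g = 0 := hg.2
  change DGCategory.d (k := k) X Z (f ≫ g) = 0
  rw [DGCategory.d_comp f hg.1, h1, h2]
  simp

variable {B} in
/-- Composition of closed morphisms of degree `0`. -/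
def Z0comp (X Y Z : B) : Z0 k X Y →ₗ[k] Z0 k Y Z →ₗ[k] Z0 k X Z :=
  LinearMap.mk₂ k (fun f g => ⟨f.1 ≫ g.1, comp_mem_Z0 k f.2 g.2⟩)
    (fun f f' g => Subtype.ext (by simp)) (fun c f g => Subtype.ext (by simp))
    (fun f g g' => Subtype.ext (by simp)) (fun c f g => Subtype.ext (by simp))

variable {B} in
lemma Z0comp_mem_right {X Y Z : B} (f : Z0 k X Y) {g : Z0 k Y Z} (hg : g ∈ B0 k Y Z) :
    Z0comp k X Y Z f g ∈ B0 k X Z := by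
  obtain ⟨h, hh⟩ := hg
  have hf : DGCategory.d (k := k) X Y f.1 = 0 := f.2.2
  have key : ∀ h : Y ⟶ Z, DGCategory.d (k := k) X Z (f.1 ≫ h) =
      f.1 ≫ DGCategory.d (k := k) Y Z h := by
    intro h
    have hmem : h ∈ ⨆ n, DGCategory.deg (k := k) Y Z n := by
      rw [(DGCategory.isInternal (k := k) Y Z).submodule_iSup_eq_top]; trivial
    induction hmem using Submodule.iSup_induction' with
    | mem n x hx => rw [DGCategory.d_comp f.1 hx, hf]; simp
    | zero => simp
    | add x y _ _ hx hy => simp [hx, hy]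
  exact ⟨f.1 ≫ h, by rw [key, hh]; rfl⟩

variable {B} in
lemma Z0comp_mem_left {X Y Z : B} {f : Z0 k X Y} (g : Z0 k Y Z) (hf : f ∈ B0 k X Y) :
    Z0comp k X Y Z f g ∈ B0 k X Z := by
  obtain ⟨h, hh⟩ := hf
  have hg : DGCategory.d (k := k) Y Z g.1 = 0 := g.2.2
  refine ⟨h ≫ g.1, ?_⟩
  rw [DGCategory.d_comp h g.2.1, hh, hg]
  simp [Z0comp]

variable {B} in
/-- Composition in `H⁰(B)`. -/
def H0comp (X Y Z : B) :
    (Z0 k X Y ⧸ B0 k X Y) →ₗ[k] (Z0 k Y Z ⧸ B0 k Y Z) →ₗ[k] (Z0 k X Z ⧸ B0 k X Z) :=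
  (B0 k X Y).liftQ
    (LinearMap.mk₂ k
      (fun f => (B0 k Y Z).mapQ (B0 k X Z) (Z0comp k X Y Z f)
        (fun _ hg => Z0comp_mem_right k f hg))
      (fun f f' g => by
        obtain ⟨g, rfl⟩ := Submodule.mkQ_surjective _ g; simp)
      (fun c f g => by
        obtain ⟨g, rfl⟩ := Submodule.mkQ_surjective _ g; simp)
      (fun f g g' => by simp) (fun c f g => by simp))
    (fun f hf => by
      refine LinearMap.ext fun g => ?_
      obtain ⟨g, rfl⟩ := Submodule.mkQ_surjective _ g
      exact (Submodule.Quotient.mk_eq_zero _).2 (Z0comp_mem_left k g hf))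

instance : Category.{w} (H0 k B) where
  Hom X Y := Z0 k X.of Y.of ⧸ B0 k X.of Y.of
  id X := Submodule.Quotient.mk ⟨𝟙 X.of, DGCategory.id_mem X.of, d_id k X.of⟩
  comp {X Y Z} f g := H0comp k X.of Y.of Z.of f g
  id_comp {X Y} f := by
    obtain ⟨f, rfl⟩ := Submodule.mkQ_surjective _ f
    exact congrArg Submodule.Quotient.mk (Subtype.ext (Category.id_comp f.1))
  comp_id {X Y} f := by
    obtain ⟨f, rfl⟩ := Submodule.mkQ_surjective _ f
    exact congrArg Submodule.Quotient.mk (Subtype.ext (Category.comp_id f.1))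
  assoc {X Y Z W} f g h := by
    obtain ⟨f, rfl⟩ := Submodule.mkQ_surjective _ f
    obtain ⟨g, rfl⟩ := Submodule.mkQ_surjective _ g
    obtain ⟨h, rfl⟩ := Submodule.mkQ_surjective _ h
    exact congrArg Submodule.Quotient.mk (Subtype.ext (Category.assoc f.1 g.1 h.1))

instance : Preadditive (H0 k B) where
  homGroup X Y := inferInstanceAs (AddCommGroup (Z0 k X.of Y.of ⧸ B0 k X.of Y.of))
  add_comp X Y Z f f' g := LinearMap.map_add₂ (H0comp k X.of Y.of Z.of) f f' g
  comp_add X Y Z f g g' := (H0comp k X.of Y.of Z.of f).map_add g g'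

instance : Linear k (H0 k B) where
  homModule X Y := inferInstanceAs (Module k (Z0 k X.of Y.of ⧸ B0 k X.of Y.of))
  smul_comp X Y Z r f g := LinearMap.map_smul₂ (H0comp k X.of Y.of Z.of) r f g
  comp_smul X Y Z f r g := (H0comp k X.of Y.of Z.of f).map_smul r g

variable {B} in
/-- The class in `H⁰(B)` of a closed morphism of degree `0`. -/
def H0.homMk {X Y : B} (f : Z0 k X Y) : (H0.mk X : H0 k B) ⟶ H0.mk Y :=
  Submodule.Quotient.mk f

variable {B} in
/-- A shift `X[n]` of an object of a dg category: an object with a closed isomorphism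
`σ : X → X[n]` of degree `-n`, whose inverse is `τ`. -/
structure DGShift (X : B) (n : ℤ) where
  obj : B
  σ : X ⟶ obj
  τ : obj ⟶ X
  σ_mem : σ ∈ DGCategory.deg (k := k) X obj (-n)
  τ_mem : τ ∈ DGCategory.deg (k := k) obj X n
  d_σ : DGCategory.d (k := k) X obj σ = 0
  d_τ : DGCategory.d (k := k) obj X τ = 0
  σ_τ : σ ≫ τ = 𝟙 X
  τ_σ : τ ≫ σ = 𝟙 obj

variable {B} in
/-- A cone of a closed morphism `f : X → Y` of degree `0` in a dg category: as a graded object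
it is `X[1] ⊕ Y`, with injections `s` (of degree `-1`) and `i`, projections `p` (of degree `1`)
and `r`, and its differential is the one of the mapping cone: `d s = i ∘ f`. (The remaining
identity `d r = - f ∘ p` is a consequence.) -/
structure DGCone {X Y : B} (f : X ⟶ Y) where
  obj : B
  i : Y ⟶ obj
  p : obj ⟶ X
  s : X ⟶ obj
  r : obj ⟶ Y
  i_mem : i ∈ DGCategory.deg (k := k) Y obj 0
  p_mem : p ∈ DGCategory.deg (k := k) obj X 1
  s_mem : s ∈ DGCategory.deg (k := k) X obj (-1)
  r_mem : r ∈ DGCategory.deg (k := k) obj Y 0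
  i_p : i ≫ p = 0
  i_r : i ≫ r = 𝟙 Y
  s_p : s ≫ p = 𝟙 X
  s_r : s ≫ r = 0
  total : p ≫ s + r ≫ i = 𝟙 obj
  d_i : DGCategory.d (k := k) Y obj i = 0
  d_p : DGCategory.d (k := k) obj X p = 0
  d_s : DGCategory.d (k := k) X obj s = f ≫ i

variable {k B}

/-- The map `X[n] → Y[n]` induced by `f : X → Y`. -/
def DGShift.map {X Y : B} {n : ℤ} (S : DGShift k X n) (T : DGShift k Y n) (f : Z0 k X Y) :
    Z0 k S.obj T.obj :=
  ⟨S.τ ≫ f.1 ≫ T.σ, by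
    have h0 : DGCategory.d (k := k) X Y f.1 = 0 := f.2.2
    refine ⟨by simpa using DGCategory.comp_mem S.τ_mem (DGCategory.comp_mem f.2.1 T.σ_mem), ?_⟩
    have h1 : DGCategory.d (k := k) X T.obj (f.1 ≫ T.σ) = 0 := by
      rw [DGCategory.d_comp f.1 T.σ_mem, T.d_σ, h0]; simp
    change DGCategory.d (k := k) S.obj T.obj (S.τ ≫ f.1 ≫ T.σ) = 0
    rw [DGCategory.d_comp S.τ (DGCategory.comp_mem f.2.1 T.σ_mem), h1, S.d_τ]
    simp⟩

/-- The inclusion `Y → Cone(f)`, a closed morphism of degree `0`. -/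
def DGCone.inr {X Y : B} {f : X ⟶ Y} (C : DGCone k f) : Z0 k Y C.obj :=
  ⟨C.i, C.i_mem, C.d_i⟩

/-- The connecting morphism `Cone(f) → X[1]`, a closed morphism of degree `0`. -/
def DGCone.δ {X Y : B} {f : X ⟶ Y} (C : DGCone k f) (S : DGShift k X 1) : Z0 k C.obj S.obj :=
  ⟨C.p ≫ S.σ, by simpa using DGCategory.comp_mem C.p_mem S.σ_mem, by
    change DGCategory.d (k := k) C.obj S.obj (C.p ≫ S.σ) = 0
    rw [DGCategory.d_comp C.p S.σ_mem, S.d_σ, C.d_p]; simp⟩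

variable (k B)

/-- A dg bimodule over `B`: spaces `M(X, Y)`, contravariant in `X` (`pre`) and covariant in `Y`
(`post`), graded and with a differential. `obj X Y` is the total space `⨁ n, M(X, Y)ⁿ`.
Writing `m ∘ f` for `pre f m` and `g ∘ m` for `post m g`, the Leibniz rules read
`d (m ∘ f) = d m ∘ f + (-1)^|m| m ∘ d f` and `d (g ∘ m) = d g ∘ m + (-1)^|g| g ∘ d m`. -/
structure DGBimodule where
  obj : B → B → Type w
  [addCommGroup (X Y : B) : AddCommGroup (obj X Y)]
  [module (X Y : B) : Module k (obj X Y)]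
  deg (X Y : B) (n : ℤ) : Submodule k (obj X Y)
  isInternal (X Y : B) : DirectSum.IsInternal (deg X Y)
  d (X Y : B) : obj X Y →ₗ[k] obj X Y
  d_mem {X Y : B} {n : ℤ} {m : obj X Y} (hm : m ∈ deg X Y n) : d X Y m ∈ deg X Y (n + 1)
  d_d {X Y : B} (m : obj X Y) : d X Y (d X Y m) = 0
  pre (X' X Y : B) : (X' ⟶ X) →ₗ[k] obj X Y →ₗ[k] obj X' Y
  post (X Y Y' : B) : obj X Y →ₗ[k] (Y ⟶ Y') →ₗ[k] obj X Y'
  pre_id {X Y : B} (m : obj X Y) : pre X X Y (𝟙 X) m = m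
  pre_comp {X'' X' X Y : B} (f' : X'' ⟶ X') (f : X' ⟶ X) (m : obj X Y) :
    pre X'' X Y (f' ≫ f) m = pre X'' X' Y f' (pre X' X Y f m)
  post_id {X Y : B} (m : obj X Y) : post X Y Y m (𝟙 Y) = m
  post_comp {X Y Y' Y'' : B} (m : obj X Y) (g : Y ⟶ Y') (g' : Y' ⟶ Y'') :
    post X Y Y'' m (g ≫ g') = post X Y' Y'' (post X Y Y' m g) g'
  pre_post {X' X Y Y' : B} (f : X' ⟶ X) (m : obj X Y) (g : Y ⟶ Y') :
    post X' Y Y' (pre X' X Y f m) g = pre X' X Y' f (post X Y Y' m g)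
  pre_mem {X' X Y : B} {p n : ℤ} {f : X' ⟶ X} {m : obj X Y}
    (hf : f ∈ DGCategory.deg (k := k) X' X p) (hm : m ∈ deg X Y n) :
    pre X' X Y f m ∈ deg X' Y (p + n)
  post_mem {X Y Y' : B} {n q : ℤ} {m : obj X Y} {g : Y ⟶ Y'}
    (hm : m ∈ deg X Y n) (hg : g ∈ DGCategory.deg (k := k) Y Y' q) :
    post X Y Y' m g ∈ deg X Y' (n + q)
  d_pre {X' X Y : B} {n : ℤ} (f : X' ⟶ X) {m : obj X Y} (hm : m ∈ deg X Y n) :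
    d X' Y (pre X' X Y f m) = pre X' X Y f (d X Y m) +
      ((n.negOnePow : ℤˣ) : ℤ) • pre X' X Y (DGCategory.d (k := k) X' X f) m
  d_post {X Y Y' : B} {q : ℤ} (m : obj X Y) {g : Y ⟶ Y'}
    (hg : g ∈ DGCategory.deg (k := k) Y Y' q) :
    d X Y' (post X Y Y' m g) = post X Y Y' m (DGCategory.d (k := k) Y Y' g) +
      ((q.negOnePow : ℤˣ) : ℤ) • post X Y Y' (d X Y m) g

attribute [instance] DGBimodule.addCommGroup DGBimodule.module

namespace DGBimodule

variable {k B}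

/-- Morphisms of dg bimodules: closed morphisms of degree `0`. -/
@[ext]
structure Hom (M N : DGBimodule k B) where
  app (X Y : B) : M.obj X Y →ₗ[k] N.obj X Y
  map_mem {X Y : B} {n : ℤ} {m : M.obj X Y} (hm : m ∈ M.deg X Y n) : app X Y m ∈ N.deg X Y n
  map_d {X Y : B} (m : M.obj X Y) : app X Y (M.d X Y m) = N.d X Y (app X Y m)
  map_pre {X' X Y : B} (f : X' ⟶ X) (m : M.obj X Y) :
    app X' Y (M.pre X' X Y f m) = N.pre X' X Y f (app X Y m)
  map_post {X Y Y' : B} (m : M.obj X Y) (g : Y ⟶ Y') :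
    app X Y' (M.post X Y Y' m g) = N.post X Y Y' (app X Y m) g

instance : Category.{w} (DGBimodule k B) where
  Hom M N := Hom M N
  id M :=
    { app X Y := LinearMap.id
      map_mem := fun hm => hm
      map_d := fun _ => rfl
      map_pre := fun _ _ => rfl
      map_post := fun _ _ => rfl }
  comp φ ψ :=
    { app X Y := ψ.app X Y ∘ₗ φ.app X Y
      map_mem := fun hm => ψ.map_mem (φ.map_mem hm)
      map_d := fun m => by simp [φ.map_d, ψ.map_d]
      map_pre := fun f m => by simp [φ.map_pre, ψ.map_pre]
      map_post := fun m g => by simp [φ.map_post, ψ.map_post] }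

/-- The diagonal bimodule `(X, Y) ↦ Hom(X, Y)`. -/
def diagonal : DGBimodule k B where
  obj X Y := X ⟶ Y
  deg X Y n := DGCategory.deg X Y n
  isInternal X Y := DGCategory.isInternal X Y
  d X Y := DGCategory.d X Y
  d_mem := DGCategory.d_mem
  d_d := DGCategory.d_d
  pre X' X Y := Linear.comp X' X Y
  post X Y Y' := Linear.comp X Y Y'
  pre_id := by simp
  pre_comp := by simp
  post_id := by simp
  post_comp := by simp
  pre_post := by simp
  pre_mem hf hm := DGCategory.comp_mem hf hm
  post_mem hm hg := DGCategory.comp_mem hm hg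
  d_pre f _ hm := DGCategory.d_comp f hm
  d_post m _ hg := DGCategory.d_comp m hg

/-- Quasi-isomorphisms: the morphisms that induce bijections on all cohomology spaces
(injectivity, then surjectivity, of the map on cohomology). -/
def quasiIso : MorphismProperty (DGBimodule k B) := fun M N φ => ∀ X Y : B,
  (∀ m : M.obj X Y, M.d X Y m = 0 → (∃ n, N.d X Y n = φ.app X Y m) → ∃ m', M.d X Y m' = m) ∧
  (∀ n : N.obj X Y, N.d X Y n = 0 → ∃ m, M.d X Y m = 0 ∧ ∃ n', N.d X Y n' = n - φ.app X Y m)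

/-- The map `Hom(X, P) ⊗ Hom(Q, Y) → M(X, Y)`, `f ⊗ g ↦ g ∘ x ∘ f`, from the representable
bimodule of `(P, Q)` that is determined by the element `x` of `M(P, Q)`. -/
def fromRepresentable (M : DGBimodule k B) {P Q : B} (x : M.obj P Q) (X Y : B) :
    (X ⟶ P) ⊗[k] (Q ⟶ Y) →ₗ[k] M.obj X Y :=
  TensorProduct.lift (M.post X Q Y ∘ₗ (M.pre X P Q).flip x)

/-- Finite semi-free bimodules, that is, finite iterated extensions of shifts of representable
bimodules: there is a finite ordered list of homogeneous elements `x i` that freely generate `M`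
as a graded bimodule, and `d (x i)` lies in the span of the earlier generators. -/
def IsFiniteSemifree (M : DGBimodule k B) : Prop :=
  ∃ (r : ℕ) (P Q : Fin r → B) (x : ∀ i, M.obj (P i) (Q i)),
    (∀ i, ∃ e : ℤ, x i ∈ M.deg (P i) (Q i) e) ∧
    (∀ i, M.d (P i) (Q i) (x i) ∈
      ⨆ j : {j : Fin r // j < i}, LinearMap.range (M.fromRepresentable (x j.1) (P i) (Q i))) ∧
    ∀ X Y : B, Function.Bijective
      (fun t : (∀ i, (X ⟶ P i) ⊗[k] (Q i ⟶ Y)) => ∑ i, M.fromRepresentable (x i) X Y (t i))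

/-- Perfect bimodules: those which are, in the derived category (the localization at the
quasi-isomorphisms), a direct summand of a finite semi-free bimodule. -/
def IsPerfect (M : DGBimodule k B) : Prop :=
  ∃ P : DGBimodule k B, P.IsFiniteSemifree ∧
    Nonempty (Retract ((quasiIso (k := k) (B := B)).Q.obj M) (quasiIso.Q.obj P))

end DGBimodule

/-- A dg category is smooth if its diagonal bimodule is perfect. -/
def IsSmooth : Prop := (DGBimodule.diagonal (k := k) (B := B)).IsPerfect

/-- A dg category is proper if all its Hom complexes have finite-dimensional total
cohomology. -/
def IsProper : Prop := ∀ X Y : B, Module.Finite k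
  (LinearMap.ker (DGCategory.d (k := k) X Y) ⧸
    (LinearMap.range (DGCategory.d (k := k) X Y)).submoduleOf
      (LinearMap.ker (DGCategory.d (k := k) X Y)))

end DG

/-! ## Triangulated categories -/

section Triangulated

variable (k : Type uk) [Field k] (D : Type u) [Category.{v} D] [Preadditive D] [Linear k D]
  [HasZeroObject D] [HasShift D ℤ] [∀ n : ℤ, (shiftFunctor D n).Additive] [Pretriangulated D]

/-- A dg enhancement of `D`: a pretriangulated dg category `B` (shifts of objects and cones of
closed morphisms of degree `0` exist in `B`) with a `k`-linear exact equivalence `H⁰(B) ≃ D`.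
Exactness: the equivalence commutes with the shift through the natural isomorphism `θ`, and it
sends the standard triangles `X → Y → Cone(f) → X[1]` to distinguished triangles. -/
structure DGEnhancement (B : Type w) [Category.{w} B] [Preadditive B] [Linear k B]
    [DGCategory k B] where
  shift (X : B) (n : ℤ) : DGShift k X n
  cone {X Y : B} (f : Z0 k X Y) : DGCone k f.1
  Φ : H0 k B ⥤ D
  isEquivalence : Φ.IsEquivalence
  additive : Φ.Additive
  linear : Φ.Linear k
  θ (X : B) : Φ.obj ⟨(shift X 1).obj⟩ ≅ (Φ.obj ⟨X⟩)⟦(1 : ℤ)⟧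
  θ_naturality {X Y : B} (f : Z0 k X Y) :
    Φ.map (H0.homMk k ((shift X 1).map (shift Y 1) f)) ≫ (θ Y).hom =
      (θ X).hom ≫ (Φ.map (H0.homMk k f))⟦(1 : ℤ)⟧'
  distinguished {X Y : B} (f : Z0 k X Y) :
    Triangle.mk (Φ.map (H0.homMk k f)) (Φ.map (H0.homMk k (cone f).inr))
      (Φ.map (H0.homMk k ((cone f).δ (shift X 1))) ≫ (θ X).hom) ∈ distTriang D

/-- A triangulated category is saturated if it admits a smooth and proper dg enhancement. -/
def IsSaturated : Prop :=
  ∃ (B : Type w) (_ : Category.{w} B) (_ : Preadditive B) (_ : Linear k B) (_ : DGCategory k B),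
    Nonempty (DGEnhancement k D B) ∧ IsSmooth k B ∧ IsProper k B

/-- `D` is of finite type: `⨁ n, Hom(X, Y[n])` is finite-dimensional for all `X`, `Y`. -/
def IsFiniteType : Prop :=
  ∀ X Y : D, Module.Finite k (⨁ n : ℤ, (X ⟶ Y⟦n⟧))

/-- A Serre functor: a `k`-linear autoequivalence `S` with isomorphisms
`Hom(X, Y) ≅ Hom(Y, S X)^*` which are natural in `X` and `Y`. -/
structure SerreFunctor where
  S : D ⥤ D
  isEquivalence : S.IsEquivalence
  additive : S.Additive
  linear : S.Linear k
  iso (X Y : D) : (X ⟶ Y) ≃ₗ[k] Module.Dual k (Y ⟶ S.obj X)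
  naturality {X' X Y Y' : D} (a : X' ⟶ X) (f : X ⟶ Y) (b : Y ⟶ Y') (g : Y' ⟶ S.obj X') :
    iso X' Y' (a ≫ f ≫ b) g = iso X Y f (b ≫ g ≫ S.map a)

variable {D}

/-- `IsTower G A ks`: there is a sequence of morphisms `0 = A₀ → A₁ → ⋯ → Aₘ ≅ A` such that the
cone of `A_(l-1) → A_l` is `G[k_l]`, where `ks` is the list `k₁, …, kₘ`. -/
inductive IsTower (G : D) : D → List ℤ → Prop
  | zero {A : D} (hA : IsZero A) : IsTower G A []
  | step {A' A : D} {ks : List ℤ} {n : ℤ} (h : IsTower G A' ks)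
      (f : A' ⟶ A) (g : A ⟶ G⟦n⟧) (δ : G⟦n⟧ ⟶ A'⟦(1 : ℤ)⟧)
      (hT : Triangle.mk f g δ ∈ distTriang D) : IsTower G A (ks ++ [n])

/-- The complexity `δ_t(G, E) ∈ [0, ∞]` of `E` relative to `G`. -/
def complexity (t : ℝ) (G E : D) : ℝ≥0∞ :=
  sInf {c | ∃ (E' A : D) (ks : List ℤ), IsTower G A ks ∧ Nonempty (A ≅ E ⊞ E') ∧
    c = ENNReal.ofReal (ks.map fun n : ℤ => Real.exp (n * t)).sum}

/-- `G` is a split generator: `δ_t(G, E) < ∞` for all `E`. -/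
def IsSplitGenerator (G : D) : Prop := ∀ (t : ℝ) (E : D), complexity t G E < ⊤

/-- No power of the endofunctor `F` is the zero functor. -/
def NotVirtuallyZero (F : D ⥤ D) : Prop := ∀ n : ℕ, ∃ X : D, ¬ IsZero (F.obj^[n] X)

/-- `h` is the categorical entropy function of `F`:
`h t = lim (1 / n) log δ_t(G, Fⁿ G)` for every split generator `G`. -/
def IsEntropyFunction (F : D ⥤ D) (h : ℝ → ℝ) : Prop :=
  ∀ (G : D), IsSplitGenerator G → ∀ t : ℝ,
    Tendsto (fun n : ℕ => ENNReal.log (complexity t G (F.obj^[n] G)) / ((n : ℝ) : EReal)) atTop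
      (𝓝 ((h t : ℝ) : EReal))

/-- `τ` is the upper shifting number of `F`, the limit of `h_t(F) / t` as `t → ∞`. -/
def IsUpperShiftingNumber (F : D ⥤ D) (τ : ℝ) : Prop :=
  ∃ h : ℝ → ℝ, IsEntropyFunction F h ∧ Tendsto (fun t => h t / t) atTop (𝓝 τ)

/-- `τ` is the lower shifting number of `F`, the limit of `h_t(F) / t` as `t → -∞`. -/
def IsLowerShiftingNumber (F : D ⥤ D) (τ : ℝ) : Prop :=
  ∃ h : ℝ → ℝ, IsEntropyFunction F h ∧ Tendsto (fun t => h t / t) atBot (𝓝 τ)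

/-- `IsCohomologyFiltration A E ks`: there is a sequence of exact triangles
`E_(l-1) → E_l → A_l[k_l] → E_(l-1)[1]`, from `E₀ = 0` to `Eₘ = E`, with nonzero objects `A_l`
of `A` and `k₁ > ⋯ > kₘ`, where `ks` is the list `k₁, …, kₘ`. -/
inductive IsCohomologyFiltration (A : ObjectProperty D) : D → List ℤ → Prop
  | zero {E : D} (hE : IsZero E) : IsCohomologyFiltration A E []
  | step {E' E a : D} {ks : List ℤ} {n : ℤ} (h : IsCohomologyFiltration A E' ks)
      (ha : A a) (ha0 : ¬ IsZero a) (hn : ∀ m ∈ ks, n < m)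
      (f : E' ⟶ E) (g : E ⟶ a⟦n⟧) (δ : a⟦n⟧ ⟶ E'⟦(1 : ℤ)⟧)
      (hT : Triangle.mk f g δ ∈ distTriang D) : IsCohomologyFiltration A E (ks ++ [n])

/-- The full additive subcategory `A` is the heart of a bounded t-structure. -/
structure IsBoundedHeart (A : ObjectProperty D) : Prop where
  of_iso {X Y : D} (e : X ≅ Y) (hX : A X) : A Y
  zero {X : D} (hX : IsZero X) : A X
  biprod {X Y : D} (hX : A X) (hY : A Y) : A (X ⊞ Y)
  hom_eq_zero {X Y : D} (hX : A X) (hY : A Y) {m n : ℤ} (h : n < m) (f : X⟦m⟧ ⟶ Y⟦n⟧) : f = 0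
  exists_filtration (E : D) (hE : ¬ IsZero E) : ∃ ks, IsCohomologyFiltration A E ks

/-- `φ⁺_A(E) = k₁`, the maximal degree of nonzero cohomology of `E ≠ 0`. The filtration of `E` is
unique when `A` is a bounded heart, so the set below is a singleton. -/
def phiPlus (A : ObjectProperty D) (E : D) : ℤ :=
  sSup {n : ℤ | ∃ ks, IsCohomologyFiltration A E (n :: ks)}

/-- `φ⁻_A(E) = kₘ`, the minimal degree of nonzero cohomology of `E ≠ 0`. -/
def phiMinus (A : ObjectProperty D) (E : D) : ℤ :=
  sInf {n : ℤ | ∃ ks, IsCohomologyFiltration A E (ks ++ [n])}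

end Triangulated

end ShiftingNumbers

end

/-!
The shifting numbers are compared with the extremal degrees of `Hom(G, Fⁿ G)`.

Write `ε_t(X, Y) = ∑ dim Hom(X, Y[n]) e^(-n t)` (`homSeries`). By the long exact sequences it is
subadditive on towers, so that `ε_t(G, E)` is bounded by a multiple of the complexity `δ_t(G, E)`.
Smoothness gives the opposite bound (`exists_complexity_le_mul_homSeries`). Call a morphism a ghost
if `Hom(G[n], -)` kills it for all `n`. Coning off bases of all `Hom(G[n], E)` is a ghost `E → E₁`
whose cone is a tower over `G` of cost at most `e^t ε_t(G, E)`, and this can be iterated. Once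
the composite `E → E_N` of `N` ghosts is zero, `E` is a direct summand of a shift of its cone, that
is, of a tower whose cost is at most a constant times `ε_t(G, E)`.

That composites of `N` ghosts vanish, for some `N` (`exists_isComposite_ghost_eq_zero`), is where
the enhancement is used. On a finite semi-free bimodule with generators in `M(P i, Q i)`, a ghost
for the objects `Q i` lowers the filtration by the generators one step on cycles, up to boundaries:
the graded pieces are `Hom(-, P i) ⊗ Hom(Q i, -)`, and over a field a chain map which is zero on
cohomology has a graded null homotopy. Hence a composite of as many ghosts as there are generators
acts by zero on the cohomology of the bimodule. Cohomology at a pair of objects is a functor which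
inverts quasi-isomorphisms, so it passes to the localization, where the diagonal bimodule is a
retract of a finite semi-free one; so the composite acts by zero on the cohomology of the diagonal
bimodule, and it is zero because it is the image of an identity morphism.

The sequence `ε_t(G, Fⁿ G)` is submultiplicative up to constants, and `ε_t ε_{-t} ≥ 1` for nonzero
objects, so Fekete's lemma gives a real growth rate `h_t`, which is also the one of the complexity
(`exists_isEntropyFunction`). If `p` is the largest number with `Hom(G, E[-p]) ≠ 0`, then
`e^(t p) ≤ ε_t(G, E) ≤ ε_0(G, E) e^(t p)` for `t ≥ 0`; therefore `h_t / t` converges, to the growth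
rate of `p` (`exists_tendsto_slope`). Finally `φ⁺` has the same growth rate as `p`: it is bounded
below by `p` up to a constant, and `e^(t φ⁺(E))` is bounded by a multiple of `δ_t(G, E)`, since a
nonzero morphism from the top cohomology to `E` induces one to some cell of a tower. The argument
for `φ⁻` is symmetric in the second bound; in the first bound, Serre duality turns a morphism
`G → E[-q]` into a morphism from `E[-q]` to a fixed object.
-/

noncomputable section

namespace ShiftingNumbers

/-! ### Graded null homotopies over a field -/

lemma exists_linearMap_of_isInternal {k V W : Type*} [Field k] [AddCommGroup V] [Module k V]
    [AddCommGroup W] [Module k W] {𝒱 : ℤ → Submodule k V} (h𝒱 : DirectSum.IsInternal 𝒱)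
    (f : ℤ → V →ₗ[k] W) : ∃ F : V →ₗ[k] W, ∀ n, ∀ x ∈ 𝒱 n, F x = f n x := by
  classical
  let e := LinearEquiv.ofBijective (DirectSum.coeLinearMap 𝒱) h𝒱
  refine ⟨DirectSum.toModule k ℤ W (fun n => f n ∘ₗ (𝒱 n).subtype) ∘ₗ e.symm.toLinearMap, ?_⟩
  intro n x hx
  have : e.symm x = DirectSum.lof k ℤ (fun n => 𝒱 n) n ⟨x, hx⟩ := by
    rw [LinearEquiv.symm_apply_eq]
    exact (DirectSum.coeLinearMap_lof 𝒱 n ⟨x, hx⟩).symm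
  simp [this]

lemma induction_of_isInternal {k V : Type*} [Field k] [AddCommGroup V] [Module k V]
    {𝒱 : ℤ → Submodule k V} (h𝒱 : DirectSum.IsInternal 𝒱) {p : V → Prop}
    (mem : ∀ n, ∀ x ∈ 𝒱 n, p x) (zero : p 0) (add : ∀ x y, p x → p y → p (x + y)) (x : V) : p x :=
  Submodule.iSup_induction 𝒱 (motive := p)
    (by rw [h𝒱.submodule_iSup_eq_top]; trivial) mem zero add

lemma exists_proj_of_isInternal {k V : Type*} [Field k] [AddCommGroup V] [Module k V]
    {𝒱 : ℤ → Submodule k V} (h𝒱 : DirectSum.IsInternal 𝒱) (n : ℤ) :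
    ∃ pr : V →ₗ[k] V, (∀ x, pr x ∈ 𝒱 n) ∧ (∀ x ∈ 𝒱 n, pr x = x) ∧
      ∀ m, m ≠ n → ∀ x ∈ 𝒱 m, pr x = 0 := by
  classical
  obtain ⟨pr, hpr⟩ := exists_linearMap_of_isInternal h𝒱
    (fun m => if m = n then LinearMap.id else (0 : V →ₗ[k] V))
  refine ⟨pr, fun x => ?_, fun x hx => by simp [hpr n x hx],
    fun m hm x hx => by simp [hpr m x hx, hm]⟩
  induction x using induction_of_isInternal h𝒱 with
  | mem m x hx =>
    rw [hpr m x hx]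
    split_ifs with h
    · subst h; exact hx
    · simp
  | zero => simp
  | add x y hx hy => rw [map_add]; exact add_mem hx hy

/-- Over a field every linear map has a generalized inverse. -/
lemma exists_generalized_inverse {k V W : Type*} [Field k] [AddCommGroup V] [Module k V]
    [AddCommGroup W] [Module k W] (d : V →ₗ[k] W) : ∃ s : W →ₗ[k] V, ∀ x, d (s (d x)) = d x := by
  obtain ⟨s₀, hs₀⟩ := d.rangeRestrict.exists_rightInverse_of_surjective d.range_rangeRestrict
  obtain ⟨s, hs⟩ := LinearMap.exists_extend s₀
  refine ⟨s, fun x => ?_⟩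
  have h1 : s (d x) = s₀ (d.rangeRestrict x) := by
    rw [← hs]; rfl
  have h2 := LinearMap.congr_fun hs₀ (d.rangeRestrict x)
  rw [h1]
  exact congrArg Subtype.val h2

/-- A chain map between complexes of vector spaces which is zero on cohomology is homotopic to
zero. -/
lemma exists_nullhomotopy {k V W : Type*} [Field k] [AddCommGroup V] [Module k V]
    [AddCommGroup W] [Module k W] (dV : V →ₗ[k] V) (dW : W →ₗ[k] W) (hdV : ∀ x, dV (dV x) = 0)
    (g : V →ₗ[k] W) (hg : ∀ x, dW (g x) = g (dV x))
    (h0 : ∀ x, dV x = 0 → ∃ y, dW y = g x) :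
    ∃ h : V →ₗ[k] W, ∀ x, dW (h x) + h (dV x) = g x := by
  obtain ⟨s, hs⟩ := exists_generalized_inverse dV
  obtain ⟨t, ht⟩ := exists_generalized_inverse dW
  -- `q` is a projection onto the cycles
  let q : V →ₗ[k] V := LinearMap.id - s ∘ₗ dV
  have hq : ∀ x, dV (q x) = 0 := fun x => by simp [q, hs]
  have hqd : ∀ x, q (dV x) = dV x := fun x => by simp [q, hdV]
  refine ⟨g ∘ₗ s ∘ₗ q + t ∘ₗ g ∘ₗ (q - dV ∘ₗ s ∘ₗ q), fun x => ?_⟩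
  obtain ⟨y, hy⟩ := h0 (q x - dV (s (q x))) (by simp [hq, hdV])
  have h1 : dW (t (g (q x - dV (s (q x))))) = g (q x - dV (s (q x))) := by rw [← hy, ht]
  simp only [LinearMap.add_apply, LinearMap.comp_apply, LinearMap.sub_apply, map_add, h1, hqd, hs,
    sub_self, map_zero, add_zero, hg]
  simp [q]

/-- A degree `0` chain map between graded complexes of vector spaces which is zero on cohomology
has a null homotopy of degree `-1`. -/
lemma exists_graded_nullhomotopy {k V W : Type*} [Field k] [AddCommGroup V] [Module k V]
    [AddCommGroup W] [Module k W] {𝒱 : ℤ → Submodule k V} {𝒲 : ℤ → Submodule k W}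
    (h𝒱 : DirectSum.IsInternal 𝒱) (h𝒲 : DirectSum.IsInternal 𝒲)
    (dV : V →ₗ[k] V) (dW : W →ₗ[k] W) (hdV : ∀ x, dV (dV x) = 0)
    (dV_mem : ∀ n, ∀ x ∈ 𝒱 n, dV x ∈ 𝒱 (n + 1)) (dW_mem : ∀ n, ∀ x ∈ 𝒲 n, dW x ∈ 𝒲 (n + 1))
    (g : V →ₗ[k] W) (g_mem : ∀ n, ∀ x ∈ 𝒱 n, g x ∈ 𝒲 n) (hg : ∀ x, dW (g x) = g (dV x))
    (h0 : ∀ n, ∀ x ∈ 𝒱 n, dV x = 0 → ∃ y, dW y = g x) :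
    ∃ h : V →ₗ[k] W, (∀ n, ∀ x ∈ 𝒱 n, h x ∈ 𝒲 (n - 1)) ∧ ∀ x, dW (h x) + h (dV x) = g x := by
  choose pV pV_mem pV_id pV_zero using exists_proj_of_isInternal h𝒱
  choose pW pW_mem pW_id pW_zero using exists_proj_of_isInternal h𝒲
  have pV_d : ∀ n x, pV (n + 1) (dV x) = dV (pV n x) := by
    intro n x
    induction x using induction_of_isInternal h𝒱 with
    | mem m x hx =>
      by_cases hm : m = n
      · subst hm; rw [pV_id _ _ (dV_mem _ _ hx), pV_id _ _ hx]
      · rw [pV_zero _ _ (by simpa using hm) _ (dV_mem _ _ hx), pV_zero _ _ hm _ hx, map_zero]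
    | zero => simp
    | add x y hx hy => simp [hx, hy]
  have pW_d : ∀ n x, pW (n + 1) (dW x) = dW (pW n x) := by
    intro n x
    induction x using induction_of_isInternal h𝒲 with
    | mem m x hx =>
      by_cases hm : m = n
      · subst hm; rw [pW_id _ _ (dW_mem _ _ hx), pW_id _ _ hx]
      · rw [pW_zero _ _ (by simpa using hm) _ (dW_mem _ _ hx), pW_zero _ _ hm _ hx, map_zero]
    | zero => simp
    | add x y hx hy => simp [hx, hy]
  -- the homogeneous components of a cycle are cycles, so `g` sends all cycles to boundaries
  have hsum : ∀ x : V, ∃ S : Finset ℤ, x = ∑ n ∈ S, pV n x := by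
    classical
    intro x
    obtain ⟨S, hS⟩ : ∃ S : Finset ℤ, ∀ T, S ⊆ T → x = ∑ n ∈ T, pV n x := by
      induction x using induction_of_isInternal h𝒱 with
      | mem m x hx =>
        refine ⟨{m}, fun T hT => ?_⟩
        rw [Finset.sum_eq_single m, pV_id _ _ hx]
        · exact fun b _ hb => pV_zero _ _ hb.symm _ hx
        · exact fun h => absurd (hT (Finset.mem_singleton_self m)) h
      | zero => exact ⟨∅, fun T _ => by simp⟩
      | add x y hx hy =>
        obtain ⟨S, hS⟩ := hx
        obtain ⟨S', hS'⟩ := hy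
        refine ⟨S ∪ S', fun T hT => ?_⟩
        simp only [map_add, Finset.sum_add_distrib]
        rw [← hS T (Finset.union_subset_left hT), ← hS' T (Finset.union_subset_right hT)]
    exact ⟨S, hS S subset_rfl⟩
  have h0' : ∀ x, dV x = 0 → ∃ y, dW y = g x := by
    intro x hx
    obtain ⟨S, hS⟩ := hsum x
    choose y hy using fun n => h0 n (pV n x) (pV_mem n x) (by rw [← pV_d, hx, map_zero])
    exact ⟨∑ n ∈ S, y n, by conv_rhs => rw [hS, map_sum]
                            simp [hy]⟩
  obtain ⟨h, hh⟩ := exists_nullhomotopy dV dW hdV g hg h0'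
  obtain ⟨h', hh'⟩ := exists_linearMap_of_isInternal h𝒱 (fun n => pW (n - 1) ∘ₗ h)
  refine ⟨h', fun n x hx => by rw [hh' n x hx]; exact pW_mem _ _, fun x => ?_⟩
  induction x using induction_of_isInternal h𝒱 with
  | mem n x hx =>
    rw [hh' n x hx, hh' (n + 1) _ (dV_mem n x hx), ← pW_id n (g x) (g_mem n x hx), ← hh x, map_add]
    simp only [LinearMap.comp_apply, ← pW_d, sub_add_cancel, add_sub_cancel_right]
  | zero => simp
  | add x y hx hy => rw [map_add, map_add, map_add, map_add, map_add, ← hx, ← hy]; abel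

/-! ### Composites of ghosts act trivially on finite semi-free bimodules -/

/-- Composites of `n` morphisms of `C`, each of which satisfies `P`. For `n = 0` these are the
identities; `eqToHom` only serves to state this for source and target which are not
syntactically equal. -/
def IsComposite {C : Type*} [Category* C] (P : MorphismProperty C) :
    ℕ → MorphismProperty C
  | 0 => fun X Y f => ∃ h : X = Y, f = eqToHom h
  | n + 1 => fun X Y f => ∃ (Z : C) (g : X ⟶ Z) (h : Z ⟶ Y),
      P g ∧ IsComposite P n h ∧ f = g ≫ h

section DG

variable {k : Type uk} [Field k] {B : Type w} [Category.{w} B] [Preadditive B]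
    [Linear k B] [DGCategory k B]

variable (k) in
/-- Ghosts for a family `Q` of objects of a dg category: closed morphisms of degree `0` which
induce zero on the cohomology of `Hom(Q i, -)` for all `i`. -/
def dgGhost {ι : Type*} (Q : ι → B) : MorphismProperty B := fun X Y f =>
  f ∈ Z0 k X Y ∧ ∀ (i : ι) (n : ℤ), ∀ v ∈ DGCategory.deg (k := k) (Q i) X n,
    DGCategory.d (k := k) (Q i) X v = 0 → ∃ y, DGCategory.d (k := k) (Q i) Y y = v ≫ f

lemma mem_Z0_of_isComposite {ι : Type*} {Q : ι → B} {n : ℕ} {X Y : B} {f : X ⟶ Y}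
    (hf : IsComposite (dgGhost k Q) n f) : f ∈ Z0 k X Y := by
  induction n generalizing X with
  | zero =>
    obtain ⟨rfl, rfl⟩ := hf
    exact ⟨DGCategory.id_mem _, d_id k _⟩
  | succ n ih =>
    obtain ⟨Z, g, h, hg, hh, rfl⟩ := hf
    exact comp_mem_Z0 k hg.1 (ih hh)

namespace DGBimodule

variable (M : DGBimodule k B)

@[simp]
lemma fromRepresentable_tmul {P Q : B} (x : M.obj P Q) (X Y : B) (f : X ⟶ P) (g : Q ⟶ Y) :
    M.fromRepresentable x X Y (f ⊗ₜ g) = M.post X Q Y (M.pre X P Q f x) g := rfl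

lemma post_fromRepresentable {P Q : B} (x : M.obj P Q) (X Y Y' : B) (g : Y ⟶ Y')
    (t : (X ⟶ P) ⊗[k] (Q ⟶ Y)) :
    M.post X Y Y' (M.fromRepresentable x X Y t) g =
      M.fromRepresentable x X Y' ((Linear.rightComp k Q g).lTensor (X ⟶ P) t) := by
  induction t using TensorProduct.induction_on with
  | zero => simp
  | tmul f v => simp [M.post_comp]
  | add a b ha hb => simp [ha, hb]

lemma pre_fromRepresentable {P Q : B} (x : M.obj P Q) (X' X Y : B) (f : X' ⟶ X)
    (t : (X ⟶ P) ⊗[k] (Q ⟶ Y)) :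
    M.pre X' X Y f (M.fromRepresentable x X Y t) =
      M.fromRepresentable x X' Y ((Linear.leftComp k P f).rTensor (Q ⟶ Y) t) := by
  induction t using TensorProduct.induction_on with
  | zero => simp
  | tmul f' v => simp [M.pre_comp, M.pre_post]
  | add a b ha hb => simp [ha, hb]

variable {M} in
lemma d_post_of_mem_Z0 {X Y Y' : B} (m : M.obj X Y) {g : Y ⟶ Y'} (hg : g ∈ Z0 k Y Y') :
    M.d X Y' (M.post X Y Y' m g) = M.post X Y Y' (M.d X Y m) g := by
  have h : DGCategory.d (k := k) Y Y' g = 0 := hg.2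
  rw [M.d_post m hg.1, h]
  simp

variable {r : ℕ} {P Q : Fin r → B} (x : ∀ i, M.obj (P i) (Q i))

/-- The part of a bimodule which is generated by the first `n` of the elements `x i`. -/
def filtration (n : ℕ) (X Y : B) : Submodule k (M.obj X Y) :=
  ⨆ j : {j : Fin r // (j : ℕ) < n}, LinearMap.range (M.fromRepresentable (x j.1) X Y)

lemma fromRepresentable_mem_filtration {n : ℕ} {X Y : B} (j : Fin r) (hj : (j : ℕ) < n)
    (t : (X ⟶ P j) ⊗[k] (Q j ⟶ Y)) :
    M.fromRepresentable (x j) X Y t ∈ M.filtration x n X Y :=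
  Submodule.mem_iSup_of_mem (p := fun j : {j : Fin r // (j : ℕ) < n} =>
    LinearMap.range (M.fromRepresentable (x j.1) X Y)) ⟨j, hj⟩ ⟨t, rfl⟩

@[elab_as_elim]
lemma filtration_induction {n : ℕ} {X Y : B} {p : ∀ z, z ∈ M.filtration x n X Y → Prop}
    (mem : ∀ (j : Fin r) (hj : (j : ℕ) < n) (t),
      p _ (M.fromRepresentable_mem_filtration x (X := X) (Y := Y) j hj t))
    (zero : p 0 (zero_mem _))
    (add : ∀ a b (ha : a ∈ M.filtration x n X Y) (hb : b ∈ M.filtration x n X Y),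
      p a ha → p b hb → p (a + b) (add_mem ha hb))
    {z : M.obj X Y} (hz : z ∈ M.filtration x n X Y) : p z hz := by
  have : ∃ h, p z h := by
    refine Submodule.iSup_induction _ (motive := fun z => ∃ h, p z h) hz ?_ ⟨_, zero⟩
      fun a b ⟨_, ha⟩ ⟨_, hb⟩ => ⟨_, add a b _ _ ha hb⟩
    rintro ⟨j, hj⟩ _ ⟨t, rfl⟩
    exact ⟨_, mem j hj t⟩
  exact this.2

lemma filtration_mono {m n : ℕ} (h : m ≤ n) (X Y : B) :
    M.filtration x m X Y ≤ M.filtration x n X Y := by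
  intro z hz
  induction hz using filtration_induction with
  | mem j hj t => exact M.fromRepresentable_mem_filtration x j (hj.trans_le h) t
  | zero => exact zero_mem _
  | add a b _ _ ha hb => exact add_mem ha hb

lemma post_mem_filtration {n : ℕ} {X Y Y' : B} {z : M.obj X Y} (hz : z ∈ M.filtration x n X Y)
    (g : Y ⟶ Y') : M.post X Y Y' z g ∈ M.filtration x n X Y' := by
  induction hz using filtration_induction with
  | mem j hj t =>
    rw [post_fromRepresentable]
    exact M.fromRepresentable_mem_filtration x j hj _
  | zero => simp
  | add a b _ _ ha hb => simpa using add_mem ha hb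

lemma pre_mem_filtration {n : ℕ} {X' X Y : B} {z : M.obj X Y} (hz : z ∈ M.filtration x n X Y)
    (f : X' ⟶ X) : M.pre X' X Y f z ∈ M.filtration x n X' Y := by
  induction hz using filtration_induction with
  | mem j hj t =>
    rw [pre_fromRepresentable]
    exact M.fromRepresentable_mem_filtration x j hj _
  | zero => simp
  | add a b _ _ ha hb => simpa using add_mem ha hb

lemma exists_of_mem_filtration_succ {n : ℕ} (hn : n < r) {X Y : B} {z : M.obj X Y}
    (hz : z ∈ M.filtration x (n + 1) X Y) :
    ∃ t, ∃ z' ∈ M.filtration x n X Y, z = M.fromRepresentable (x ⟨n, hn⟩) X Y t + z' := by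
  induction hz using filtration_induction with
  | mem j hj t =>
    obtain h | h := Nat.lt_succ_iff_lt_or_eq.1 hj
    · exact ⟨0, _, M.fromRepresentable_mem_filtration x j h t, by simp⟩
    · obtain rfl : j = ⟨n, hn⟩ := Fin.ext h
      exact ⟨t, 0, zero_mem _, by simp⟩
  | zero => exact ⟨0, 0, zero_mem _, by simp⟩
  | add a b _ _ ha hb =>
    obtain ⟨t, z, hz, rfl⟩ := ha
    obtain ⟨t', z', hz', rfl⟩ := hb
    exact ⟨t + t', z + z', add_mem hz hz', by rw [map_add]; abel⟩

lemma eq_zero_of_fromRepresentable_mem_filtration {X Y : B}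
    (hx : Function.Injective (fun t : (∀ i, (X ⟶ P i) ⊗[k] (Q i ⟶ Y)) =>
      ∑ i, M.fromRepresentable (x i) X Y (t i)))
    {i : Fin r} {t : (X ⟶ P i) ⊗[k] (Q i ⟶ Y)}
    (h : M.fromRepresentable (x i) X Y t ∈ M.filtration x i X Y) : t = 0 := by
  have key : ∀ {z : M.obj X Y}, z ∈ M.filtration x i X Y →
      ∃ u : (∀ i, (X ⟶ P i) ⊗[k] (Q i ⟶ Y)), u i = 0 ∧
        ∑ i, M.fromRepresentable (x i) X Y (u i) = z := by
    intro z hz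
    induction hz using filtration_induction with
    | mem j hj t =>
      refine ⟨Pi.single j t, Pi.single_eq_of_ne (Fin.ne_of_gt hj) _, ?_⟩
      rw [Finset.sum_eq_single j]
      · simp
      · intro b _ hb; rw [Pi.single_eq_of_ne hb, map_zero]
      · simp
    | zero => exact ⟨0, rfl, by simp⟩
    | add a b _ _ ha hb =>
      obtain ⟨u, hu, rfl⟩ := ha
      obtain ⟨u', hu', rfl⟩ := hb
      exact ⟨u + u', by simp [hu, hu'], by simp [Finset.sum_add_distrib]⟩
  obtain ⟨u, hu, hu'⟩ := key h
  have : u = Pi.single i t := by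
    apply hx
    simp only
    rw [hu', Finset.sum_eq_single i]
    · simp
    · intro b _ hb; rw [Pi.single_eq_of_ne hb, map_zero]
    · simp
  rw [this] at hu
  simpa using hu

/-- The differential of a semi-free bimodule respects the filtration by the generators, and on the
graded pieces it is the differential of the representable bimodules. -/
lemma exists_sign_d_fromRepresentable (i : Fin r) {e : ℤ}
    (he : x i ∈ M.deg (P i) (Q i) e)
    (hd : M.d (P i) (Q i) (x i) ∈
      ⨆ j : {j : Fin r // j < i}, LinearMap.range (M.fromRepresentable (x j.1) (P i) (Q i)))
    (X Y : B) (f : X ⟶ P i) {n : ℤ} {v : Q i ⟶ Y} (hv : v ∈ DGCategory.deg (k := k) (Q i) Y n) :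
    M.d X Y (M.fromRepresentable (x i) X Y (f ⊗ₜ v)) -
      M.fromRepresentable (x i) X Y (f ⊗ₜ[k] DGCategory.d (k := k) (Q i) Y v +
        ((n.negOnePow : ℤˣ) : ℤ) • ((e.negOnePow : ℤˣ) : ℤ) •
          (DGCategory.d (k := k) X (P i) f ⊗ₜ[k] v)) ∈ M.filtration x i X Y := by
  have hd' : M.d (P i) (Q i) (x i) ∈ M.filtration x i (P i) (Q i) := hd
  rw [map_add, map_zsmul, map_zsmul]
  simp only [fromRepresentable_tmul]
  rw [M.d_post _ hv, M.d_pre _ he]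
  simp only [map_add, LinearMap.add_apply, map_zsmul, LinearMap.smul_apply, smul_add]
  have := M.post_mem_filtration x (M.pre_mem_filtration x hd' f) v
  have h2 := zsmul_mem this (((n.negOnePow : ℤˣ) : ℤ))
  convert h2 using 1
  abel

/-- On a finite semi-free bimodule, a ghost for the second entries of the generators lowers the
filtration by one step, up to boundaries: by the Künneth formula it is zero on the cohomology of
the graded pieces `Hom(-, P i) ⊗ Hom(Q i, -)`. -/
lemma exists_post_sub_d_mem_filtration
    (hbij : ∀ X Y : B, Function.Bijective (fun t : (∀ i, (X ⟶ P i) ⊗[k] (Q i ⟶ Y)) =>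
      ∑ i, M.fromRepresentable (x i) X Y (t i)))
    (hdeg : ∀ i, ∃ e : ℤ, x i ∈ M.deg (P i) (Q i) e)
    (hd : ∀ i, M.d (P i) (Q i) (x i) ∈
      ⨆ j : {j : Fin r // j < i}, LinearMap.range (M.fromRepresentable (x j.1) (P i) (Q i)))
    {n : ℕ} (hn : n < r) {X Y Y' : B} {z : M.obj X Y} (hz : z ∈ M.filtration x (n + 1) X Y)
    (hdz : M.d X Y z = 0) {g : Y ⟶ Y'} (hg : dgGhost k Q g) :
    ∃ y, M.post X Y Y' z g - M.d X Y' y ∈ M.filtration x n X Y' := by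
  obtain ⟨e, he⟩ := hdeg ⟨n, hn⟩
  set i : Fin r := ⟨n, hn⟩ with hi
  -- the sign operator and the differential of `Hom(X, P i) ⊗ Hom(Q i, Y)`
  have hσ : ∀ Z : B, ∃ σ : (Q i ⟶ Z) →ₗ[k] (Q i ⟶ Z), ∀ m,
      ∀ v ∈ DGCategory.deg (k := k) (Q i) Z m, σ v = ((m.negOnePow : ℤˣ) : ℤ) • v := by
    intro Z
    obtain ⟨σ, hσ⟩ := exists_linearMap_of_isInternal (DGCategory.isInternal (k := k) (Q i) Z)
      (fun m => ((m.negOnePow : ℤˣ) : ℤ) • (LinearMap.id : (Q i ⟶ Z) →ₗ[k] (Q i ⟶ Z)))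
    exact ⟨σ, fun m v hv => by rw [hσ m v hv]; rfl⟩
  choose σ hσ using hσ
  let δ : ∀ Z : B, (X ⟶ P i) ⊗[k] (Q i ⟶ Z) →ₗ[k] (X ⟶ P i) ⊗[k] (Q i ⟶ Z) := fun Z =>
    (DGCategory.d (k := k) (Q i) Z).lTensor _ +
      ((e.negOnePow : ℤˣ) : ℤ) • TensorProduct.map (DGCategory.d (k := k) X (P i)) (σ Z)
  have hδ : ∀ (Z : B) (t : (X ⟶ P i) ⊗[k] (Q i ⟶ Z)),
      M.d X Z (M.fromRepresentable (x i) X Z t) - M.fromRepresentable (x i) X Z (δ Z t) ∈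
        M.filtration x n X Z := by
    intro Z t
    induction t using TensorProduct.induction_on with
    | zero => simp
    | tmul f v =>
      induction v using induction_of_isInternal (DGCategory.isInternal (k := k) (Q i) Z) with
      | mem m v hv =>
        have := M.exists_sign_d_fromRepresentable x i he (hd i) X Z f hv
        convert this using 3
        simp only [δ, LinearMap.add_apply, LinearMap.lTensor_tmul, LinearMap.smul_apply,
          TensorProduct.map_tmul, hσ Z m v hv]
        rw [TensorProduct.tmul_smul, smul_comm]
      | zero => simp
      | add v w hv hw =>
        rw [TensorProduct.tmul_add]
        simp only [map_add]
        convert add_mem hv hw using 1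
        abel
    | add a b ha hb =>
      simp only [map_add]
      convert add_mem ha hb using 1
      abel
  have hstable : ∀ (Z : B) (z : M.obj X Z), z ∈ M.filtration x n X Z →
      M.d X Z z ∈ M.filtration x n X Z := by
    intro Z z hz
    induction hz using filtration_induction with
    | mem j hj t =>
      obtain ⟨e', he'⟩ := hdeg j
      have hle := M.filtration_mono x hj.le X Z
      induction t using TensorProduct.induction_on with
      | zero => simp
      | tmul f v =>
        induction v using induction_of_isInternal (DGCategory.isInternal (k := k) (Q j) Z) with
        | mem m v hv =>
          have := hle (M.exists_sign_d_fromRepresentable x j he' (hd j) X Z f hv)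
          exact (Submodule.sub_mem_iff_left _
            (M.fromRepresentable_mem_filtration x j hj _)).1 this
        | zero => simp
        | add v w hv hw =>
          rw [TensorProduct.tmul_add]
          simp only [map_add]
          exact add_mem hv hw
      | add a b ha hb =>
        simp only [map_add]
        exact add_mem ha hb
    | zero => simp
    | add a b _ _ ha hb => rw [map_add]; exact add_mem ha hb
  obtain ⟨t, z', hz', rfl⟩ := M.exists_of_mem_filtration_succ x hn hz
  have ht : δ Y t = 0 := by
    apply M.eq_zero_of_fromRepresentable_mem_filtration x (hbij X Y).1 (i := i)
    rw [map_add] at hdz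
    have h1 := hδ Y t
    rw [eq_neg_of_add_eq_zero_left hdz] at h1
    have h2 := add_mem h1 (hstable Y z' hz')
    rw [← Submodule.neg_mem_iff]
    convert h2 using 1
    abel
  have hgd : DGCategory.d (k := k) Y Y' g = 0 := hg.1.2
  have hgd' : ∀ v : Q i ⟶ Y, DGCategory.d (k := k) (Q i) Y' (v ≫ g) =
      DGCategory.d (k := k) (Q i) Y v ≫ g := by
    intro v
    rw [DGCategory.d_comp v hg.1.1, hgd]
    simp
  obtain ⟨h, h_mem, hh⟩ := exists_graded_nullhomotopy
    (DGCategory.isInternal (k := k) (Q i) Y) (DGCategory.isInternal (k := k) (Q i) Y')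
    (DGCategory.d (k := k) (Q i) Y) (DGCategory.d (k := k) (Q i) Y') DGCategory.d_d
    (fun _ _ => DGCategory.d_mem) (fun _ _ => DGCategory.d_mem) (Linear.rightComp k (Q i) g)
    (fun m v hv => by simpa using DGCategory.comp_mem hv hg.1.1) hgd' (hg.2 i)
  -- `h` has odd degree, so that `1 ⊗ h` is a null homotopy of `1 ⊗ g`
  have hσh : ∀ v, σ Y' (h v) = - h (σ Y v) := by
    intro v
    induction v using induction_of_isInternal (DGCategory.isInternal (k := k) (Q i) Y) with
    | mem m v hv =>
      rw [hσ Y m v hv, hσ Y' _ _ (h_mem m v hv), map_zsmul, Int.negOnePow_sub]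
      simp
    | zero => simp
    | add v w hv hw => simp only [map_add, hv, hw]; abel
  have key : ∀ t, δ Y' (h.lTensor _ t) + h.lTensor _ (δ Y t) =
      (Linear.rightComp k (Q i) g).lTensor (X ⟶ P i) t := by
    intro t
    induction t using TensorProduct.induction_on with
    | zero => simp
    | tmul f v =>
      simp only [δ, LinearMap.add_apply, LinearMap.lTensor_tmul, LinearMap.smul_apply,
        TensorProduct.map_tmul, map_add, map_zsmul, hσh, TensorProduct.tmul_neg, ← hh v,
        TensorProduct.tmul_add, smul_neg]
      abel
    | add a b ha hb =>
      simp only [map_add, ← ha, ← hb]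
      abel
  refine ⟨M.fromRepresentable (x i) X Y' (h.lTensor _ t), ?_⟩
  have h1 := key t
  rw [ht, map_zero, add_zero] at h1
  rw [map_add, LinearMap.add_apply, post_fromRepresentable, ← h1]
  have h2 := sub_mem (M.post_mem_filtration x hz' g) (hδ Y' (h.lTensor _ t))
  convert h2 using 1
  abel

/-- A composite of `n` ghosts sends the cycles in the `n`-th step of the filtration of a finite
semi-free bimodule to boundaries. -/
lemma exists_d_eq_post_of_isComposite
    (hbij : ∀ X Y : B, Function.Bijective (fun t : (∀ i, (X ⟶ P i) ⊗[k] (Q i ⟶ Y)) =>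
      ∑ i, M.fromRepresentable (x i) X Y (t i)))
    (hdeg : ∀ i, ∃ e : ℤ, x i ∈ M.deg (P i) (Q i) e)
    (hd : ∀ i, M.d (P i) (Q i) (x i) ∈
      ⨆ j : {j : Fin r // j < i}, LinearMap.range (M.fromRepresentable (x j.1) (P i) (Q i)))
    {n : ℕ} (hn : n ≤ r) {X Y Y' : B} {z : M.obj X Y} (hz : z ∈ M.filtration x n X Y)
    (hdz : M.d X Y z = 0) {g : Y ⟶ Y'} (hg : IsComposite (dgGhost k Q) n g) :
    ∃ y, M.d X Y' y = M.post X Y Y' z g := by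
  induction n generalizing Y with
  | zero =>
    have : z = 0 := by
      clear hdz
      induction hz using filtration_induction with
      | mem j hj t => exact absurd hj (Nat.not_lt_zero _)
      | zero => rfl
      | add a b ha hb _ _ => simp_all
    exact ⟨0, by simp [this]⟩
  | succ n ih =>
    obtain ⟨Z, g, g', hg, hg', rfl⟩ := hg
    have hcl := mem_Z0_of_isComposite hg'
    obtain ⟨y, hy⟩ := M.exists_post_sub_d_mem_filtration x hbij hdeg hd hn hz hdz hg
    obtain ⟨y', hy'⟩ := ih (by omega) hy
      (by rw [map_sub, M.d_d, d_post_of_mem_Z0 z hg.1, hdz]; simp) hg'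
    refine ⟨y' + M.post X Z Y' y g', ?_⟩
    rw [map_add, hy', d_post_of_mem_Z0 y hcl, M.post_comp]
    simp

/-- The cohomology of a dg bimodule at `(X, Y)`. -/
abbrev cohomology (X Y : B) : Type w :=
  LinearMap.ker (M.d X Y) ⧸ (LinearMap.range (M.d X Y)).submoduleOf (LinearMap.ker (M.d X Y))

variable {M} in
/-- The map on cohomology which is induced by a morphism of bimodules. -/
def cohomologyMap {N : DGBimodule k B} (φ : M ⟶ N) (X Y : B) :
    M.cohomology X Y →ₗ[k] N.cohomology X Y :=
  Submodule.mapQ _ _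
    ((Hom.app φ X Y).restrict (p := LinearMap.ker (M.d X Y)) (q := LinearMap.ker (N.d X Y))
      (fun m hm => by
        have hm' : M.d X Y m = 0 := hm
        change N.d X Y _ = 0
        rw [← Hom.map_d φ, hm', map_zero]))
    (by
      rintro ⟨m, hm⟩ ⟨y, hy⟩
      refine ⟨Hom.app φ X Y y, ?_⟩
      rw [← Hom.map_d φ, hy]
      rfl)

variable (k B) in
/-- The functor which sends a dg bimodule to its cohomology at `(X, Y)`. -/
def cohomologyFunctor (X Y : B) : DGBimodule k B ⥤ ModuleCat.{w} k where
  obj M := ModuleCat.of k (M.cohomology X Y)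
  map φ := ModuleCat.ofHom (cohomologyMap φ X Y)
  map_id M := by
    ext m
    rfl
  map_comp φ ψ := by
    ext m
    rfl

/-- The map on cohomology which is induced by a closed morphism in the second variable. -/
def cohomologyPost (X : B) {Y Y' : B} (g : Z0 k Y Y') :
    M.cohomology X Y →ₗ[k] M.cohomology X Y' :=
  Submodule.mapQ _ _
    (((M.post X Y Y').flip g.1).restrict (p := LinearMap.ker (M.d X Y))
      (q := LinearMap.ker (M.d X Y')) (fun m hm => by
        have hm' : M.d X Y m = 0 := hm
        change M.d X Y' (M.post X Y Y' m g.1) = 0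
        rw [d_post_of_mem_Z0 m g.2, hm', map_zero, LinearMap.zero_apply]))
    (by
      rintro ⟨m, hm⟩ ⟨y, hy⟩
      refine ⟨M.post X Y Y' y g.1, ?_⟩
      rw [d_post_of_mem_Z0 y g.2, hy]
      rfl)

variable (k B) in
/-- The natural transformation between cohomology functors induced by a closed morphism. -/
def cohomologyNatTrans (X : B) {Y Y' : B} (g : Z0 k Y Y') :
    cohomologyFunctor k B X Y ⟶ cohomologyFunctor k B X Y' where
  app M := ModuleCat.ofHom (M.cohomologyPost X g)
  naturality M N φ := by
    refine ModuleCat.hom_ext (LinearMap.ext fun m => ?_)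
    obtain ⟨m, rfl⟩ := Submodule.mkQ_surjective
      ((LinearMap.range (M.d X Y)).submoduleOf (LinearMap.ker (M.d X Y))) m
    exact congrArg Submodule.Quotient.mk (Subtype.ext (Hom.map_post φ m.1 g.1).symm)

lemma cohomologyFunctor_inverts (X Y : B) :
    (quasiIso (k := k) (B := B)).IsInvertedBy (cohomologyFunctor k B X Y) := by
  intro M N φ hφ
  have hbij : Function.Bijective (cohomologyMap φ X Y) := by
    refine ⟨?_, fun n => ?_⟩
    · rw [← LinearMap.ker_eq_bot, LinearMap.ker_eq_bot']
      intro m hm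
      obtain ⟨⟨m, hm'⟩, rfl⟩ := Submodule.mkQ_surjective _ m
      obtain ⟨n, hn⟩ := (Submodule.Quotient.mk_eq_zero _).1 hm
      obtain ⟨m', hm''⟩ := (hφ X Y).1 m hm' ⟨n, hn⟩
      exact (Submodule.Quotient.mk_eq_zero _).2 ⟨m', hm''⟩
    · obtain ⟨⟨n, hn⟩, rfl⟩ := Submodule.mkQ_surjective _ n
      obtain ⟨m, hm, n', hn'⟩ := (hφ X Y).2 n hn
      refine ⟨Submodule.Quotient.mk ⟨m, hm⟩, ?_⟩
      refine Eq.symm ((Submodule.Quotient.eq _).2 ⟨n', hn'⟩)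
  exact (LinearEquiv.ofBijective _ hbij).toModuleIso.isIso_hom

end DGBimodule

/-- In a smooth dg category composites of sufficiently many ghosts for a suitable finite family
of objects are null-homotopic. -/
lemma exists_family_of_isSmooth (h : IsSmooth k B) : ∃ (r : ℕ) (Q : Fin r → B),
    ∀ {X Y : B} {f : X ⟶ Y}, IsComposite (dgGhost k Q) r f →
      ∃ y, DGCategory.d (k := k) X Y y = f := by
  obtain ⟨M, ⟨r, P, Q, x, hdeg, hd, hbij⟩, ⟨ρ⟩⟩ := h
  refine ⟨r, Q, fun {X Y f} hf => ?_⟩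
  let g : Z0 k X Y := ⟨f, mem_Z0_of_isComposite hf⟩
  let W := DGBimodule.quasiIso (k := k) (B := B)
  have hfilt : ∀ z : M.obj X X, z ∈ M.filtration x r X X := by
    intro z
    obtain ⟨t, rfl⟩ := (hbij X X).2 z
    exact sum_mem fun i _ => M.fromRepresentable_mem_filtration x i i.2 _
  have hM : (DGBimodule.cohomologyNatTrans k B X g).app M = 0 := by
    refine ModuleCat.hom_ext (LinearMap.ext fun m => ?_)
    obtain ⟨⟨m, hm⟩, rfl⟩ := Submodule.mkQ_surjective
      ((LinearMap.range (M.d X X)).submoduleOf (LinearMap.ker (M.d X X))) m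
    exact (Submodule.Quotient.mk_eq_zero _).2
      (M.exists_d_eq_post_of_isComposite x hbij hdeg hd le_rfl (hfilt m) hm hf)
  have hY := DGBimodule.cohomologyFunctor_inverts (k := k) X X
  have hY' := DGBimodule.cohomologyFunctor_inverts (k := k) X Y
  let H := Localization.lift _ hY W.Q
  let H' := Localization.lift _ hY' W.Q
  let τ : H ⟶ H' := Localization.liftNatTrans W.Q W _ _ H H'
    (DGBimodule.cohomologyNatTrans k B X g)
  have hτM : τ.app (W.Q.obj M) = 0 := by
    rw [Localization.liftNatTrans_app, hM]
    simp
  have hτΔ : τ.app (W.Q.obj DGBimodule.diagonal) = 0 := by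
    have h1 : ρ.i ≫ ρ.r = 𝟙 (W.Q.obj DGBimodule.diagonal) := ρ.retract
    rw [← Category.comp_id (τ.app _), ← H'.map_id, ← h1, H'.map_comp, ← Category.assoc,
      ← τ.naturality, hτM]
    simp
  have hΔ : (DGBimodule.cohomologyNatTrans k B X g).app DGBimodule.diagonal = 0 := by
    rw [Localization.liftNatTrans_app] at hτΔ
    simpa using hτΔ
  have h0 : DGBimodule.cohomologyPost (k := k) DGBimodule.diagonal X g
      (Submodule.Quotient.mk ⟨𝟙 X, d_id k X⟩) = 0 := by
    have h1 : DGBimodule.cohomologyPost (k := k) DGBimodule.diagonal X g = 0 :=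
      congrArg ModuleCat.Hom.hom hΔ
    rw [h1]
    rfl
  obtain ⟨y, hy⟩ := (Submodule.Quotient.mk_eq_zero _).1 h0
  exact ⟨y, hy.trans (Category.id_comp f)⟩

end DG

/-! ### Ghosts in a saturated triangulated category -/

lemma IsComposite.mono {C : Type*} [Category* C] {P P' : MorphismProperty C} (h : P ≤ P') {n : ℕ}
    {X Y : C} {f : X ⟶ Y} (hf : IsComposite P n f) : IsComposite P' n f := by
  induction n generalizing X with
  | zero => exact hf
  | succ n ih =>
    obtain ⟨Z, g, g', hg, hg', rfl⟩ := hf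
    exact ⟨Z, g, g', h _ hg, ih hg', rfl⟩

lemma IsComposite.exists_of_add {C : Type*} [Category* C] {P : MorphismProperty C} {m n : ℕ}
    {X Y : C} {f : X ⟶ Y} (hf : IsComposite P (m + n) f) :
    ∃ (Z : C) (g : X ⟶ Z) (h : Z ⟶ Y), IsComposite P m g ∧ IsComposite P n h ∧ f = g ≫ h := by
  induction m generalizing X with
  | zero => exact ⟨X, 𝟙 X, f, ⟨rfl, rfl⟩, by simpa using hf, by simp⟩
  | succ m ih =>
    rw [show m + 1 + n = (m + n) + 1 by omega] at hf
    obtain ⟨Z, g, g', hg, hg', rfl⟩ := hf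
    obtain ⟨Z', h, h', hh, hh', rfl⟩ := ih hg'
    exact ⟨Z', g ≫ h, h', ⟨Z, g, h, hg, hh, rfl⟩, hh', by simp⟩

lemma IsComposite.of_one {C : Type*} [Category* C] {P : MorphismProperty C}
    {X Y : C} {f : X ⟶ Y} (hf : IsComposite P 1 f) : P f := by
  obtain ⟨Z, g, g', hg, ⟨rfl, rfl⟩, rfl⟩ := hf
  simpa using hg

lemma IsComposite.of_mul {C : Type*} [Category* C] {P : MorphismProperty C} {m n : ℕ}
    {X Y : C} {f : X ⟶ Y} (hf : IsComposite P (n * m) f) : IsComposite (IsComposite P m) n f := by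
  induction n generalizing X with
  | zero => simpa [IsComposite] using hf
  | succ n ih =>
    rw [show (n + 1) * m = m + n * m by ring] at hf
    obtain ⟨Z, g, g', hg, hg', rfl⟩ := hf.exists_of_add
    exact ⟨Z, g, g', hg, ih hg', rfl⟩

section DG

variable {k : Type uk} [Field k] {B : Type w} [Category.{w} B] [Preadditive B]
    [Linear k B] [DGCategory k B]

lemma d_comp_of_closed {X Y Z : B} {f : X ⟶ Y} (hf : DGCategory.d (k := k) X Y f = 0)
    (h : Y ⟶ Z) :
    DGCategory.d (k := k) X Z (f ≫ h) = f ≫ DGCategory.d (k := k) Y Z h := by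
  induction h using induction_of_isInternal (DGCategory.isInternal (k := k) Y Z) with
  | mem n x hx => rw [DGCategory.d_comp f hx, hf]; simp
  | zero => simp
  | add x y hx hy => simp [hx, hy]

lemma H0.homMk_comp {X Y Z : B} (f : Z0 k X Y) (g : Z0 k Y Z) :
    H0.homMk k f ≫ H0.homMk k g = H0.homMk k (⟨f.1 ≫ g.1, comp_mem_Z0 k f.2 g.2⟩ : Z0 k X Z) :=
  rfl

lemma H0.homMk_eq_zero_iff {X Y : B} (f : Z0 k X Y) :
    H0.homMk k f = 0 ↔ ∃ y, DGCategory.d (k := k) X Y y = f.1 :=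
  Submodule.Quotient.mk_eq_zero _

lemma H0.homMk_surjective {X Y : H0 k B} (f : X ⟶ Y) :
    ∃ g : Z0 k X.of Y.of, H0.homMk k g = f :=
  Submodule.mkQ_surjective _ f

/-- The object `X` as a shift of itself by `0`. -/
def DGShift.refl (X : B) : DGShift k X 0 where
  obj := X
  σ := 𝟙 X
  τ := 𝟙 X
  σ_mem := by simpa using DGCategory.id_mem X
  τ_mem := DGCategory.id_mem X
  d_σ := d_id k X
  d_τ := d_id k X
  σ_τ := by simp
  τ_σ := by simp

/-- A shift of a shift. -/
def DGShift.trans {X : B} {m n : ℤ} (S : DGShift k X m) (T : DGShift k S.obj n) :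
    DGShift k X (m + n) where
  obj := T.obj
  σ := S.σ ≫ T.σ
  τ := T.τ ≫ S.τ
  σ_mem := by
    rw [neg_add]
    exact DGCategory.comp_mem S.σ_mem T.σ_mem
  τ_mem := by
    rw [add_comm]
    exact DGCategory.comp_mem T.τ_mem S.τ_mem
  d_σ := by rw [d_comp_of_closed S.d_σ, T.d_σ, comp_zero]
  d_τ := by rw [d_comp_of_closed T.d_τ, S.d_τ, comp_zero]
  σ_τ := by rw [Category.assoc, reassoc_of% T.σ_τ, S.σ_τ]
  τ_σ := by rw [Category.assoc, reassoc_of% S.τ_σ, T.τ_σ]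

/-- Shifts by `n` are unique up to isomorphism in the homotopy category. -/
def DGShift.iso {X : B} {n : ℤ} (S T : DGShift k X n) :
    (H0.mk S.obj : H0 k B) ≅ H0.mk T.obj where
  hom := H0.homMk k ⟨S.τ ≫ T.σ, by simpa using DGCategory.comp_mem S.τ_mem T.σ_mem, by
    change DGCategory.d (k := k) _ _ (S.τ ≫ T.σ) = 0
    rw [d_comp_of_closed S.d_τ, T.d_σ, comp_zero]⟩
  inv := H0.homMk k ⟨T.τ ≫ S.σ, by simpa using DGCategory.comp_mem T.τ_mem S.σ_mem, by
    change DGCategory.d (k := k) _ _ (T.τ ≫ S.σ) = 0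
    rw [d_comp_of_closed T.d_τ, S.d_σ, comp_zero]⟩
  hom_inv_id := by
    rw [H0.homMk_comp]
    exact congrArg (H0.homMk k) (Subtype.ext (by
      simp only [Category.assoc, reassoc_of% T.σ_τ, S.τ_σ]))
  inv_hom_id := by
    rw [H0.homMk_comp]
    exact congrArg (H0.homMk k) (Subtype.ext (by
      simp only [Category.assoc, reassoc_of% S.σ_τ, T.τ_σ]))

end DG

section Triangulated

variable {k : Type uk} [Field k] {D : Type u} [Category.{v} D] [Preadditive D] [Linear k D]
  [HasZeroObject D] [HasShift D ℤ] [∀ n : ℤ, (shiftFunctor D n).Additive] [Pretriangulated D]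

lemma yoneda_exact_shift {X₁ X₂ X₃ : D} {f : X₁ ⟶ X₂} {g : X₂ ⟶ X₃} {δ : X₃ ⟶ X₁⟦(1 : ℤ)⟧}
    (hT : Triangle.mk f g δ ∈ distTriang D) (n : ℤ) {Y : D} (u : X₂⟦n⟧ ⟶ Y)
    (hu : (f⟦n⟧') ≫ u = 0) : ∃ w : X₃⟦n⟧ ⟶ Y, u = (g⟦n⟧') ≫ w := by
  obtain ⟨w, hw⟩ := Triangle.yoneda_exact₂ _ (Triangle.shift_distinguished _ hT n) u (by
    change (n.negOnePow • (f⟦n⟧')) ≫ u = 0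
    rw [Linear.units_smul_comp, hu, smul_zero])
  let w' : X₃⟦n⟧ ⟶ Y := w
  have hw' : u = (n.negOnePow • (g⟦n⟧')) ≫ w' := hw
  exact ⟨n.negOnePow • w', by rw [hw', Linear.units_smul_comp, Linear.comp_units_smul]⟩

lemma coyoneda_exact_shift {X₁ X₂ X₃ : D} {f : X₁ ⟶ X₂} {g : X₂ ⟶ X₃} {δ : X₃ ⟶ X₁⟦(1 : ℤ)⟧}
    (hT : Triangle.mk f g δ ∈ distTriang D) (n : ℤ) {Y : D} (u : Y ⟶ X₂⟦n⟧)
    (hu : u ≫ (g⟦n⟧') = 0) : ∃ w : Y ⟶ X₁⟦n⟧, u = w ≫ (f⟦n⟧') := by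
  obtain ⟨w, hw⟩ := Triangle.coyoneda_exact₂ _ (Triangle.shift_distinguished _ hT n) u (by
    change u ≫ (n.negOnePow • (g⟦n⟧')) = 0
    rw [Linear.comp_units_smul, hu, smul_zero])
  let w' : Y ⟶ X₁⟦n⟧ := w
  have hw' : u = w' ≫ (n.negOnePow • (f⟦n⟧')) := hw
  exact ⟨n.negOnePow • w', by rw [hw', Linear.units_smul_comp, Linear.comp_units_smul]⟩

/-- Ghosts for an object `G`: the morphisms which induce zero on `Hom(G[n], -)` for all `n`. -/
def ghost (G : D) : MorphismProperty D := fun X _ f => ∀ (n : ℤ) (u : G⟦n⟧ ⟶ X), u ≫ f = 0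

lemma DGEnhancement.nonempty_shift_iso {B : Type w} [Category.{w} B] [Preadditive B] [Linear k B]
    [DGCategory k B] (α : DGEnhancement k D B) (X : B) (n : ℤ) :
    Nonempty (α.Φ.obj ⟨(α.shift X n).obj⟩ ≅ (α.Φ.obj ⟨X⟩)⟦n⟧) := by
  have key : ∀ n : ℤ, Nonempty (α.Φ.obj ⟨(α.shift X (n + 1)).obj⟩ ≅
      (α.Φ.obj ⟨(α.shift X n).obj⟩)⟦(1 : ℤ)⟧) := fun n =>
    ⟨α.Φ.mapIso (DGShift.iso (α.shift X (n + 1)) ((α.shift X n).trans (α.shift _ 1))) ≪≫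
      α.θ (α.shift X n).obj⟩
  induction n using Int.induction_on with
  | zero => exact ⟨α.Φ.mapIso (DGShift.iso (α.shift X 0) (DGShift.refl X)) ≪≫
      ((shiftFunctorZero D ℤ).app _).symm⟩
  | succ n ih =>
    obtain ⟨e⟩ := ih
    obtain ⟨e'⟩ := key n
    exact ⟨e' ≪≫ (shiftFunctor D (1 : ℤ)).mapIso e ≪≫
      ((shiftFunctorAdd' D (n : ℤ) 1 (n + 1) rfl).app _).symm⟩
  | pred n ih =>
    obtain ⟨e⟩ := ih
    obtain ⟨e'⟩ := key (-n - 1)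
    rw [sub_add_cancel] at e'
    exact ⟨(shiftFunctor D (1 : ℤ)).preimageIso (e'.symm ≪≫ e ≪≫
      (shiftFunctorAdd' D (-(n : ℤ) - 1) 1 (-n) (by ring)).app _)⟩

/-- A morphism of the homotopy category which is a ghost for the objects `Q i` comes from ghosts
of the dg category. -/
lemma DGEnhancement.dgGhost_of_ghost {B : Type w} [Category.{w} B] [Preadditive B] [Linear k B]
    [DGCategory k B] (α : DGEnhancement k D B) {ι : Type*} (Q : ι → B) {X Y : B} (g : Z0 k X Y)
    (hg : ∀ i, ghost (α.Φ.obj ⟨Q i⟩) (α.Φ.map (H0.homMk k g))) : dgGhost k Q g.1 := by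
  have := α.isEquivalence
  have := α.additive
  refine ⟨g.2, fun i n v hv hdv => ?_⟩
  let S := α.shift (Q i) (-n)
  obtain ⟨e⟩ := α.nonempty_shift_iso (Q i) (-n)
  let u : Z0 k S.obj X := ⟨S.τ ≫ v, by simpa using DGCategory.comp_mem S.τ_mem hv, by
    change DGCategory.d (k := k) _ _ (S.τ ≫ v) = 0
    rw [d_comp_of_closed S.d_τ, hdv, comp_zero]⟩
  have h1 := hg i (-n) (e.inv ≫ α.Φ.map (H0.homMk k u))
  rw [Category.assoc, ← α.Φ.map_comp, H0.homMk_comp] at h1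
  have h2 := (cancel_epi e.inv).1 (h1.trans comp_zero.symm)
  rw [Functor.map_eq_zero_iff, H0.homMk_eq_zero_iff] at h2
  obtain ⟨y, hy⟩ := h2
  refine ⟨S.σ ≫ y, ?_⟩
  rw [d_comp_of_closed S.d_σ, hy]
  simp only [u, Category.assoc, reassoc_of% S.σ_τ]

/-- In a saturated category, composites of sufficiently many ghosts for a suitable finite family
of objects vanish. -/
lemma exists_family_of_isSaturated (h : IsSaturated.{w} k D) : ∃ (r : ℕ) (R : Fin r → D),
    ∀ {X Y : D} {f : X ⟶ Y}, IsComposite (⨅ i, ghost (R i)) r f → f = 0 := by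
  obtain ⟨B, _, _, _, _, ⟨α⟩, hsm, -⟩ := h
  obtain ⟨r, Q, hQ⟩ := exists_family_of_isSmooth hsm
  have := α.isEquivalence
  have := α.additive
  refine ⟨r, fun i => α.Φ.obj ⟨Q i⟩, fun {X Y f} hf => ?_⟩
  let Ψ := α.Φ.inv
  have key : ∀ (n : ℕ) {X Y : D} {f : X ⟶ Y},
      IsComposite (⨅ i, ghost (α.Φ.obj ⟨Q i⟩)) n f →
      ∃ g : Z0 k (Ψ.obj X).of (Ψ.obj Y).of, IsComposite (dgGhost k Q) n g.1 ∧
        H0.homMk k g = Ψ.map f := by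
    intro n
    induction n with
    | zero =>
      rintro X _ _ ⟨rfl, rfl⟩
      exact ⟨⟨𝟙 _, DGCategory.id_mem _, d_id k _⟩, ⟨rfl, rfl⟩, (Ψ.map_id X).symm⟩
    | succ n ih =>
      rintro X Y _ ⟨Z, f, f', hf, hf', rfl⟩
      obtain ⟨g', hg', hg''⟩ := ih hf'
      obtain ⟨g, hg⟩ := H0.homMk_surjective (Ψ.map f)
      refine ⟨⟨g.1 ≫ g'.1, comp_mem_Z0 k g.2 g'.2⟩, ⟨_, g.1, g'.1, ?_, hg', rfl⟩, ?_⟩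
      · refine α.dgGhost_of_ghost Q g fun i m u => ?_
        have hfi : ghost (α.Φ.obj ⟨Q i⟩) f := by
          have := hf
          simp only [MorphismProperty.iInf_iff] at this
          exact this i
        have h1 := hfi m (u ≫ α.Φ.asEquivalence.counit.app X)
        have h2 := α.Φ.asEquivalence.counit.naturality f
        have h3 : (u ≫ α.Φ.map (Ψ.map f)) ≫ α.Φ.asEquivalence.counit.app Z = 0 :=
          (Category.assoc _ _ _).trans
            ((congrArg (u ≫ ·) h2).trans ((Category.assoc _ _ _).symm.trans h1))
        rw [hg]
        exact (cancel_mono (α.Φ.asEquivalence.counit.app Z)).1 (h3.trans zero_comp.symm)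
      · rw [Ψ.map_comp, ← hg, ← hg'']
        rfl
  obtain ⟨g, hg, hg'⟩ := key r hf
  have h0 : Ψ.map f = 0 := by
    rw [← hg', H0.homMk_eq_zero_iff]
    exact hQ hg
  have : α.Φ.asEquivalence.functor.Additive := α.additive
  have : Ψ.Additive := inferInstanceAs (α.Φ.asEquivalence.inverse.Additive)
  exact (Functor.map_eq_zero_iff Ψ).1 h0

/-- Ghost lemma: a composite of as many `G`-ghosts as a tower has cells is a ghost for the total
object of the tower. -/
lemma IsTower.ghost_of_isComposite {G A : D} {ks : List ℤ} (hA : IsTower G A ks) {X Y : D}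
    {f : X ⟶ Y} (hf : IsComposite (ghost G) ks.length f) : ghost A f := by
  induction hA generalizing Y with
  | zero hA => exact fun n u => ((shiftFunctor D n).map_isZero hA).eq_of_src _ _
  | @step A' A ks m h f₁ f₂ δ hT ih =>
    rw [List.length_append] at hf
    obtain ⟨Z, g, g', hg, hg', rfl⟩ := hf.exists_of_add
    intro n u
    have h1 : (f₁⟦n⟧') ≫ u ≫ g = 0 := by
      rw [← Category.assoc]
      exact ih hg n _
    obtain ⟨w, hw⟩ := yoneda_exact_shift hT n _ h1
    have h2 := hg'.of_one (m + n) ((shiftFunctorAdd D m n).hom.app G ≫ w)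
    rw [Category.assoc] at h2
    have h3 := (cancel_epi ((shiftFunctorAdd D m n).hom.app G)).1 (h2.trans comp_zero.symm)
    rw [← Category.assoc, hw, Category.assoc, h3, comp_zero]

lemma IsSplitGenerator.exists_tower {G : D} (hG : IsSplitGenerator G) (E : D) :
    ∃ (A : D) (ks : List ℤ), IsTower G A ks ∧ Nonempty (Retract E A) := by
  obtain ⟨_, ⟨E', A, ks, h, ⟨e⟩, -⟩, -⟩ := sInf_lt_iff.1 (hG 0 E)
  exact ⟨A, ks, h, ⟨{ i := biprod.inl ≫ e.inv, r := e.hom ≫ biprod.fst }⟩⟩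

/-- In a saturated category, composites of sufficiently many ghosts for a split generator vanish. -/
lemma exists_isComposite_ghost_eq_zero (h : IsSaturated.{w} k D) {G : D}
    (hG : IsSplitGenerator G) :
    ∃ n : ℕ, ∀ {X Y : D} {f : X ⟶ Y}, IsComposite (ghost G) n f → f = 0 := by
  obtain ⟨r, R, hR⟩ := exists_family_of_isSaturated h
  choose A ks hA ρ using fun i => hG.exists_tower (R i)
  refine ⟨r * ∑ i, (ks i).length, fun {X Y f} hf => hR (hf.of_mul.mono ?_)⟩
  intro X Y f hf
  rw [MorphismProperty.iInf_iff]
  intro i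
  obtain ⟨m, hm⟩ := Nat.exists_eq_add_of_le
    (Finset.single_le_sum (f := fun i => (ks i).length) (fun _ _ => Nat.zero_le _)
      (Finset.mem_univ i))
  rw [hm] at hf
  obtain ⟨Z, g, g', hg, -, rfl⟩ := hf.exists_of_add
  intro n u
  obtain ⟨ρ⟩ := ρ i
  have h1 := (hA i).ghost_of_isComposite hg n ((ρ.r⟦n⟧') ≫ u)
  have h2 : (ρ.i⟦n⟧') ≫ (ρ.r⟦n⟧') = 𝟙 _ := by
    rw [← Functor.map_comp, ρ.retract, CategoryTheory.Functor.map_id]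
  rw [← Category.id_comp u, ← h2]
  rw [Category.assoc] at h1
  simp only [Category.assoc]
  rw [reassoc_of% h1]
  simp

end Triangulated

/-! ### Graded dimensions of morphism spaces -/

/-- The weight `e^(n t)` of a shift by `n`. -/
def weight (t : ℝ) (n : ℤ) : ℝ≥0∞ := ENNReal.ofReal (Real.exp (n * t))

@[simp] lemma weight_zero_right (t : ℝ) : weight t 0 = 1 := by simp [weight]

lemma weight_add (t : ℝ) (m n : ℤ) : weight t (m + n) = weight t m * weight t n := by
  rw [weight, weight, weight, ← ENNReal.ofReal_mul (Real.exp_nonneg _), ← Real.exp_add]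
  push_cast
  ring_nf

lemma weight_ne_top (t : ℝ) (n : ℤ) : weight t n ≠ ⊤ := ENNReal.ofReal_ne_top

lemma weight_ne_zero (t : ℝ) (n : ℤ) : weight t n ≠ 0 := by
  simp [weight, Real.exp_pos]

lemma weight_neg_left (t : ℝ) (n : ℤ) : weight (-t) n = weight t (-n) := by
  simp [weight]

/-- The cost `∑ e^(k t)` of a list of shifts. -/
def cost (t : ℝ) (ks : List ℤ) : ℝ≥0∞ := (ks.map (weight t)).sum

@[simp] lemma cost_nil (t : ℝ) : cost t [] = 0 := rfl

lemma cost_append (t : ℝ) (ks ls : List ℤ) : cost t (ks ++ ls) = cost t ks + cost t ls := by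
  simp [cost]

lemma cost_singleton (t : ℝ) (n : ℤ) : cost t [n] = weight t n := by simp [cost]

lemma ofReal_sum_exp (t : ℝ) (ks : List ℤ) :
    ENNReal.ofReal (ks.map fun n : ℤ => Real.exp (n * t)).sum = cost t ks := by
  induction ks with
  | nil => simp
  | cons n ks ih =>
    rw [← List.singleton_append, cost_append, cost_singleton, List.map_append, List.sum_append,
      ENNReal.ofReal_add, ih]
    · simp [weight]
    · simp [Real.exp_nonneg]
    · exact List.sum_nonneg (by simp only [List.mem_map]; rintro _ ⟨n, -, rfl⟩; positivity)

lemma weight_le_cost {t : ℝ} {ks : List ℤ} {n : ℤ} (hn : n ∈ ks) : weight t n ≤ cost t ks :=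
  List.single_le_sum (fun _ _ => zero_le) _ (List.mem_map_of_mem hn)

section

variable (k : Type uk) [Field k] {D : Type u} [Category.{v} D] [Preadditive D] [Linear k D]
  [HasShift D ℤ]

/-- The dimension of `Hom(X, Y[n])`. -/
def homDim (X Y : D) (n : ℤ) : ℕ := Module.finrank k (X ⟶ Y⟦n⟧)

/-- The Poincaré series `∑ dim Hom(X, Y[n]) e^(-n t)` of the graded space of morphisms from `X`
to `Y`. -/
def homSeries (t : ℝ) (X Y : D) : ℝ≥0∞ := ∑' n : ℤ, homDim k X Y n * weight t (-n)

variable {k}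

lemma IsFiniteType.finite (h : IsFiniteType k D) (X Y : D) (n : ℤ) :
    Module.Finite k (X ⟶ Y⟦n⟧) := by
  have := h X Y
  refine Module.Finite.of_surjective (DirectSum.component k ℤ (fun n => (X ⟶ Y⟦n⟧)) n) fun f =>
    ⟨DirectSum.lof k ℤ (fun n => (X ⟶ Y⟦n⟧)) n f, ?_⟩
  exact DirectSum.component.lof_self k _ _

lemma IsFiniteType.finite_setOf_ne_zero (h : IsFiniteType k D) (X Y : D) :
    {n : ℤ | ∃ f : X ⟶ Y⟦n⟧, f ≠ 0}.Finite := by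
  classical
  obtain ⟨s, hs⟩ := (h X Y).fg_top
  have key : ∀ x : ⨁ n : ℤ, (X ⟶ Y⟦n⟧), ∀ n ∉ s.biUnion (fun y => DFinsupp.support y), x n = 0 := by
    intro x n hn
    have hx : x ∈ Submodule.span k (s : Set (⨁ n : ℤ, (X ⟶ Y⟦n⟧))) := by rw [hs]; trivial
    induction hx using Submodule.span_induction with
    | mem x hx =>
      by_contra h0
      exact hn (Finset.mem_biUnion.2 ⟨x, hx, DFinsupp.mem_support_iff.2 h0⟩)
    | zero => rfl
    | add x y _ _ hx hy => rw [DirectSum.add_apply, hx, hy, add_zero]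
    | smul a x _ hx => rw [DirectSum.smul_apply, hx, smul_zero]
  refine (s.biUnion (fun y => DFinsupp.support y)).finite_toSet.subset ?_
  rintro n ⟨f, hf⟩
  by_contra hn
  have := key (DirectSum.lof k ℤ (fun n => (X ⟶ Y⟦n⟧)) n f) n hn
  rw [DirectSum.lof_apply] at this
  exact hf this

lemma IsFiniteType.homDim_eq_zero_iff (h : IsFiniteType k D) {X Y : D} {n : ℤ} :
    homDim k X Y n = 0 ↔ ∀ f : X ⟶ Y⟦n⟧, f = 0 := by
  have := h.finite X Y n
  rw [homDim, Module.finrank_zero_iff]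
  exact ⟨fun _ f => Subsingleton.elim _ _, fun h => ⟨fun f g => (h f).trans (h g).symm⟩⟩

lemma IsFiniteType.homSeries_ne_top (h : IsFiniteType k D) (t : ℝ) (X Y : D) :
    homSeries k t X Y ≠ ⊤ := by
  rw [homSeries, tsum_eq_sum (s := (h.finite_setOf_ne_zero X Y).toFinset)]
  · exact ENNReal.sum_ne_top.2 fun n _ =>
      ENNReal.mul_ne_top (ENNReal.natCast_ne_top _) (weight_ne_top _ _)
  · intro n hn
    rw [h.homDim_eq_zero_iff.2, Nat.cast_zero, zero_mul]
    intro f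
    by_contra hf
    exact hn ((h.finite_setOf_ne_zero X Y).mem_toFinset.2 ⟨f, hf⟩)

lemma IsFiniteType.weight_le_homSeries (h : IsFiniteType k D) (t : ℝ) {X Y : D} {n : ℤ}
    {f : X ⟶ Y⟦n⟧} (hf : f ≠ 0) : weight t (-n) ≤ homSeries k t X Y := by
  have h1 : 1 ≤ homDim k X Y n :=
    Nat.one_le_iff_ne_zero.2 fun h0 => hf (h.homDim_eq_zero_iff.1 h0 f)
  calc weight t (-n) = 1 * weight t (-n) := (one_mul _).symm
    _ ≤ homDim k X Y n * weight t (-n) := by gcongr; exact_mod_cast h1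
    _ ≤ homSeries k t X Y := ENNReal.le_tsum n

lemma IsFiniteType.one_le_homSeries_self (h : IsFiniteType k D) (t : ℝ) {E : D}
    (hE : ¬ IsZero E) : 1 ≤ homSeries k t E E := by
  have : (shiftFunctorZero D ℤ).inv.app E ≠ 0 := by
    intro h0
    apply hE
    refine (IsZero.iff_id_eq_zero E).2 ?_
    have h1 := (shiftFunctorZero D ℤ).inv_hom_id_app E
    rw [h0, zero_comp] at h1
    exact h1.symm
  simpa using h.weight_le_homSeries t this

lemma homSeries_mono {t : ℝ} {X Y X' Y' : D} (h : ∀ n, homDim k X Y n ≤ homDim k X' Y' n) :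
    homSeries k t X Y ≤ homSeries k t X' Y' :=
  ENNReal.tsum_le_tsum fun n => by gcongr; exact h n

lemma homSeries_le_add {t : ℝ} {X Y X₁ Y₁ X₂ Y₂ : D}
    (h : ∀ n, homDim k X Y n ≤ homDim k X₁ Y₁ n + homDim k X₂ Y₂ n) :
    homSeries k t X Y ≤ homSeries k t X₁ Y₁ + homSeries k t X₂ Y₂ := by
  rw [homSeries, homSeries, homSeries, ← ENNReal.tsum_add]
  refine ENNReal.tsum_le_tsum fun n => ?_
  rw [← add_mul]
  gcongr
  exact_mod_cast h n

lemma IsFiniteType.homSeries_le_of_retract_right (h : IsFiniteType k D) (t : ℝ) (X : D) {Y Y' : D}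
    (ρ : Retract Y Y') : homSeries k t X Y ≤ homSeries k t X Y' := by
  refine homSeries_mono fun n => ?_
  have := h.finite X Y' n
  refine LinearMap.finrank_le_finrank_of_injective (f := Linear.rightComp k X (ρ.i⟦n⟧')) ?_
  intro f g hfg
  have h1 : (ρ.i⟦n⟧') ≫ (ρ.r⟦n⟧') = 𝟙 _ := by
    rw [← Functor.map_comp, ρ.retract, CategoryTheory.Functor.map_id]
  have h2 : f ≫ (ρ.i⟦n⟧') = g ≫ (ρ.i⟦n⟧') := hfg
  rw [← Category.comp_id f, ← h1, reassoc_of% h2, h1, Category.comp_id]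

lemma IsFiniteType.homSeries_le_of_retract_left (h : IsFiniteType k D) (t : ℝ) {X X' : D} (Y : D)
    (ρ : Retract X X') : homSeries k t X Y ≤ homSeries k t X' Y := by
  refine homSeries_mono fun n => ?_
  have := h.finite X' Y n
  refine LinearMap.finrank_le_finrank_of_injective (f := Linear.leftComp k (Y⟦n⟧) ρ.r) ?_
  intro f g hfg
  have h2 : ρ.r ≫ f = ρ.r ≫ g := hfg
  rw [← Category.id_comp f, ← ρ.retract, Category.assoc, h2, ← Category.assoc, ρ.retract,
    Category.id_comp]

lemma homSeries_shift_right (t : ℝ) (X Y : D) (m : ℤ) :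
    homSeries k t X (Y⟦m⟧) = weight t m * homSeries k t X Y := by
  have h1 : ∀ n, homDim k X (Y⟦m⟧) n = homDim k X Y (m + n) := fun n =>
    (Linear.homCongr k (Iso.refl X) ((shiftFunctorAdd D m n).app Y).symm).finrank_eq
  rw [homSeries, homSeries, ← ENNReal.tsum_mul_left,
    ← (Equiv.addLeft m).tsum_eq (fun n => weight t m * (homDim k X Y n * weight t (-n)))]
  refine tsum_congr fun n => ?_
  rw [h1, Equiv.coe_addLeft, mul_left_comm, ← weight_add]
  ring_nf

lemma homSeries_shift_left [∀ n : ℤ, (shiftFunctor D n).Additive]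
    [∀ n : ℤ, (shiftFunctor D n).Linear k] (t : ℝ) (X Y : D) (m : ℤ) :
    homSeries k t (X⟦m⟧) Y = weight t (-m) * homSeries k t X Y := by
  have h1 : ∀ n, homDim k (X⟦m⟧) Y (n + m) = homDim k X Y n := fun n =>
    ((LinearEquiv.ofBijective ((shiftFunctor D m).mapLinearMap k (X := X) (Y := Y⟦n⟧))
      ⟨(shiftFunctor D m).map_injective, (shiftFunctor D m).map_surjective⟩).trans
      (Linear.homCongr k (Iso.refl _) ((shiftFunctorAdd D n m).app Y).symm)).finrank_eq.symm
  rw [homSeries, homSeries, ← ENNReal.tsum_mul_left,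
    ← (Equiv.addRight m).tsum_eq (fun n => homDim k (X⟦m⟧) Y n * weight t (-n))]
  refine tsum_congr fun n => ?_
  rw [Equiv.coe_addRight, h1, mul_left_comm, ← weight_add]
  ring_nf

lemma homSeries_eq_zero_right [∀ n : ℤ, (shiftFunctor D n).Additive] {t : ℝ} {X Y : D} (hY : IsZero Y) : homSeries k t X Y = 0 := by
  refine ENNReal.tsum_eq_zero.2 fun n => ?_
  have : Subsingleton (X ⟶ Y⟦n⟧) := ⟨((shiftFunctor D n).map_isZero hY).eq_of_tgt⟩
  rw [homDim, Module.finrank_zero_of_subsingleton, Nat.cast_zero, zero_mul]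

lemma homSeries_eq_zero_left {t : ℝ} {X Y : D} (hX : IsZero X) : homSeries k t X Y = 0 := by
  refine ENNReal.tsum_eq_zero.2 fun n => ?_
  have : Subsingleton (X ⟶ Y⟦n⟧) := ⟨hX.eq_of_src⟩
  rw [homDim, Module.finrank_zero_of_subsingleton, Nat.cast_zero, zero_mul]

end

lemma finrank_le_add_of_exact {k V₁ V₂ V₃ : Type*} [Field k] [AddCommGroup V₁] [Module k V₁]
    [AddCommGroup V₂] [Module k V₂] [AddCommGroup V₃] [Module k V₃] [Module.Finite k V₁]
    [Module.Finite k V₂] [Module.Finite k V₃] (f : V₁ →ₗ[k] V₂) (g : V₂ →ₗ[k] V₃)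
    (h : LinearMap.ker g ≤ LinearMap.range f) :
    Module.finrank k V₂ ≤ Module.finrank k V₁ + Module.finrank k V₃ := by
  rw [← LinearMap.finrank_range_add_finrank_ker g, add_comm]
  exact add_le_add ((Submodule.finrank_mono h).trans (LinearMap.finrank_range_le f))
    (Submodule.finrank_le _)

section Triangulated

variable {k : Type uk} [Field k] {D : Type u} [Category.{v} D] [Preadditive D] [Linear k D]
  [HasZeroObject D] [HasShift D ℤ] [∀ n : ℤ, (shiftFunctor D n).Additive] [Pretriangulated D]

lemma IsFiniteType.homSeries_le_right (h : IsFiniteType k D) (t : ℝ) (X : D) {Y₁ Y₂ Y₃ : D}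
    {f : Y₁ ⟶ Y₂} {g : Y₂ ⟶ Y₃} {δ : Y₃ ⟶ Y₁⟦(1 : ℤ)⟧} (hT : Triangle.mk f g δ ∈ distTriang D) :
    homSeries k t X Y₂ ≤ homSeries k t X Y₁ + homSeries k t X Y₃ := by
  refine homSeries_le_add fun n => ?_
  have := h.finite X Y₁ n
  have := h.finite X Y₂ n
  have := h.finite X Y₃ n
  refine finrank_le_add_of_exact (Linear.rightComp k X (f⟦n⟧')) (Linear.rightComp k X (g⟦n⟧')) ?_
  intro u hu
  obtain ⟨w, rfl⟩ := coyoneda_exact_shift hT n u hu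
  exact ⟨w, rfl⟩

lemma IsFiniteType.homSeries_le_left (h : IsFiniteType k D) (t : ℝ) (Y : D) {X₁ X₂ X₃ : D}
    {f : X₁ ⟶ X₂} {g : X₂ ⟶ X₃} {δ : X₃ ⟶ X₁⟦(1 : ℤ)⟧} (hT : Triangle.mk f g δ ∈ distTriang D) :
    homSeries k t X₂ Y ≤ homSeries k t X₁ Y + homSeries k t X₃ Y := by
  refine (homSeries_le_add fun n => ?_).trans_eq (add_comm _ _)
  have := h.finite X₁ Y n
  have := h.finite X₂ Y n
  have := h.finite X₃ Y n
  refine finrank_le_add_of_exact (Linear.leftComp k (Y⟦n⟧) g) (Linear.leftComp k (Y⟦n⟧) f) ?_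
  intro u hu
  obtain ⟨w, rfl⟩ := Triangle.yoneda_exact₂ _ hT u hu
  exact ⟨w, rfl⟩

lemma IsTower.homSeries_le_right (h : IsFiniteType k D) (t : ℝ) (X : D) {G A : D} {ks : List ℤ}
    (hA : IsTower G A ks) : homSeries k t X A ≤ cost t ks * homSeries k t X G := by
  induction hA with
  | zero hA => simp [homSeries_eq_zero_right hA]
  | step _ f g δ hT ih =>
    refine (h.homSeries_le_right t X hT).trans ?_
    rw [cost_append, add_mul, homSeries_shift_right, cost_singleton]
    gcongr

lemma IsTower.homSeries_le_left [∀ n : ℤ, (shiftFunctor D n).Linear k] (h : IsFiniteType k D)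
    (t : ℝ) (Y : D) {G A : D} {ks : List ℤ}
    (hA : IsTower G A ks) : homSeries k t A Y ≤ cost (-t) ks * homSeries k t G Y := by
  induction hA with
  | zero hA => simp [homSeries_eq_zero_left hA]
  | step _ f g δ hT ih =>
    refine (h.homSeries_le_left t Y hT).trans ?_
    rw [cost_append, add_mul, homSeries_shift_left, cost_singleton, weight_neg_left]
    gcongr

lemma complexity_eq (t : ℝ) (G E : D) : complexity t G E =
    sInf {c | ∃ (E' A : D) (ks : List ℤ), IsTower G A ks ∧ Nonempty (A ≅ E ⊞ E') ∧
      c = cost t ks} := by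
  simp only [complexity, ofReal_sum_exp]

lemma complexity_le_cost (t : ℝ) {G E E' A : D} {ks : List ℤ} (hA : IsTower G A ks)
    (e : A ≅ E ⊞ E') : complexity t G E ≤ cost t ks := by
  rw [complexity_eq]
  exact sInf_le ⟨E', A, ks, hA, ⟨e⟩, rfl⟩

/-- The retraction of a biproduct onto its first summand. -/
def retractBiprod {E E' A : D} (e : A ≅ E ⊞ E') : Retract E A where
  i := biprod.inl ≫ e.inv
  r := e.hom ≫ biprod.fst

/-- A bound in terms of the costs of all towers which contain `E` as a retract is a bound in terms
of the complexity of `E`. The generator is needed when `a = 0`, since an infinite complexity times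
`0` is `0`. -/
lemma IsSplitGenerator.le_complexity_mul {G : D} (hG : IsSplitGenerator G) (t : ℝ) {E : D}
    {a b : ℝ≥0∞} (ha : a ≠ ⊤)
    (h : ∀ (A : D) (ks : List ℤ), IsTower G A ks → Nonempty (Retract E A) → b ≤ cost t ks * a) :
    b ≤ complexity t G E * a := by
  obtain rfl | ha0 := eq_or_ne a 0
  · obtain ⟨A, ks, hA, ρ⟩ := hG.exists_tower E
    simpa using h A ks hA ρ
  rw [← ENNReal.div_le_iff ha0 ha, complexity_eq]
  refine le_sInf ?_
  rintro _ ⟨E', A, ks, hA, ⟨e⟩, rfl⟩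
  rw [ENNReal.div_le_iff ha0 ha]
  exact h A ks hA ⟨retractBiprod e⟩

lemma IsSplitGenerator.homSeries_le_complexity_mul {G : D} (hG : IsSplitGenerator G)
    (h : IsFiniteType k D) (t : ℝ) (X E : D) :
    homSeries k t X E ≤ complexity t G E * homSeries k t X G :=
  hG.le_complexity_mul t (h.homSeries_ne_top t X G) fun _ _ hA ⟨ρ⟩ =>
    (h.homSeries_le_of_retract_right t X ρ).trans (hA.homSeries_le_right h t X)

lemma IsSplitGenerator.homSeries_le_complexity_mul_left [∀ n : ℤ, (shiftFunctor D n).Linear k]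
    {G : D} (hG : IsSplitGenerator G) (h : IsFiniteType k D) (t : ℝ) (X Y : D) :
    homSeries k t X Y ≤ complexity (-t) G X * homSeries k t G Y :=
  hG.le_complexity_mul (-t) (h.homSeries_ne_top t G Y) fun _ _ hA ⟨ρ⟩ =>
    (h.homSeries_le_of_retract_left t Y ρ).trans (hA.homSeries_le_left h t Y)

lemma IsTower.step_of_iso {G A' A C : D} {ks : List ℤ} {n : ℤ} (h : IsTower G A' ks)
    {f : A' ⟶ A} {g : A ⟶ C} {δ : C ⟶ A'⟦(1 : ℤ)⟧} (hT : Triangle.mk f g δ ∈ distTriang D)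
    (e : C ≅ G⟦n⟧) : IsTower G A (ks ++ [n]) := by
  refine .step h f (g ≫ e.hom) (e.inv ≫ δ) (isomorphic_distinguished _ hT _ ?_)
  refine Triangle.isoMk _ _ (Iso.refl _) (Iso.refl _) e.symm ?_ ?_ ?_
  · exact (Category.comp_id _).trans (Category.id_comp _).symm
  · change (g ≫ e.hom) ≫ e.inv = 𝟙 _ ≫ g
    simp
  · change (e.inv ≫ δ) ≫ (𝟙 _)⟦(1 : ℤ)⟧' = e.inv ≫ δ
    simp

lemma IsTower.map {F : D ⥤ D} [F.CommShift ℤ] [F.IsTriangulated] {G A : D} {ks : List ℤ}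
    (hA : IsTower G A ks) : IsTower (F.obj G) (F.obj A) ks := by
  induction hA with
  | zero hA => exact .zero (F.map_isZero hA)
  | @step A' A ks n h f g δ hT ih =>
    exact ih.step_of_iso (F.map_distinguished _ hT) ((F.commShiftIso n).app G)

/-- A power of a triangulated endofunctor sends towers over `G` to towers over the image of `G`
with the same shifts. -/
lemma IsSplitGenerator.homSeries_iterate_le {G : D} (hG : IsSplitGenerator G)
    (h : IsFiniteType k D) (F : D ⥤ D) [F.CommShift ℤ] [F.IsTriangulated] (t : ℝ) (X E : D)
    (n : ℕ) :
    homSeries k t X (F.obj^[n] E) ≤ complexity t G E * homSeries k t X (F.obj^[n] G) := by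
  refine hG.le_complexity_mul t (h.homSeries_ne_top t X _) fun A ks hA ⟨ρ⟩ => ?_
  have key : ∀ n : ℕ, IsTower (F.obj^[n] G) (F.obj^[n] A) ks ∧
      Nonempty (Retract (F.obj^[n] E) (F.obj^[n] A)) := by
    intro n
    induction n with
    | zero => exact ⟨hA, ⟨ρ⟩⟩
    | succ n ih =>
      simp only [Function.iterate_succ_apply']
      exact ⟨ih.1.map, ⟨(ih.2.some).map F⟩⟩
  exact (h.homSeries_le_of_retract_right t X (key n).2.some).trans
    ((key n).1.homSeries_le_right h t X)

end Triangulated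

/-! ### Complexity is bounded by graded dimensions -/

lemma IsComposite.snoc {C : Type*} [Category* C] {P : MorphismProperty C} {n : ℕ}
    {X Y Z : C} {f : X ⟶ Y} {g : Y ⟶ Z} (hf : IsComposite P n f) (hg : P g) :
    IsComposite P (n + 1) (f ≫ g) := by
  induction n generalizing X with
  | zero =>
    obtain ⟨rfl, rfl⟩ := hf
    exact ⟨Z, g, 𝟙 Z, hg, ⟨rfl, rfl⟩, by simp⟩
  | succ n ih =>
    obtain ⟨W, h, h', hh, hh', rfl⟩ := hf
    exact ⟨W, h, h' ≫ g, hh, ih hh', by simp⟩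

section Triangulated

variable {k : Type uk} [Field k] {D : Type u} [Category.{v} D] [Preadditive D] [Linear k D]
  [HasZeroObject D] [HasShift D ℤ] [∀ n : ℤ, (shiftFunctor D n).Additive] [Pretriangulated D]

/-- A morphism `f : E ⟶ E'` with a cone which is a tower of shifts of `G` by the list `ks`. -/
def HasTowerCone (G : D) {E E' : D} (f : E ⟶ E') (ks : List ℤ) : Prop :=
  ∃ (B : D) (g : E' ⟶ B) (δ : B ⟶ E⟦(1 : ℤ)⟧), Triangle.mk f g δ ∈ distTriang D ∧ IsTower G B ks

/-- Coning off a morphism `u : G[n] ⟶ E'` adds one cell `G[n + 1]` to the cone. -/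
lemma HasTowerCone.exists_cone [IsTriangulated D] {G E E' : D} {f : E ⟶ E'} {ks : List ℤ}
    (hf : HasTowerCone G f ks) {n : ℤ} (u : G⟦n⟧ ⟶ E') :
    ∃ (E'' : D) (g : E' ⟶ E''), u ≫ g = 0 ∧ HasTowerCone G (f ≫ g) (ks ++ [n + 1]) := by
  obtain ⟨B, v, δ, hT, hB⟩ := hf
  obtain ⟨E'', g, w, hT'⟩ := distinguished_cocone_triangle u
  obtain ⟨B', v', δ', hT''⟩ := distinguished_cocone_triangle (f ≫ g)
  refine ⟨E'', g, comp_distTriang_mor_zero₁₂ _ hT', B', v', δ', hT'', ?_⟩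
  exact hB.step_of_iso (Triangulated.someOctahedron rfl hT (rot_of_distTriang _ hT') hT'').mem
    ((shiftFunctorAdd D n 1).app G).symm

lemma HasTowerCone.exists_cone_list [IsTriangulated D] {G E E' : D} {f : E ⟶ E'} {ks : List ℤ}
    (hf : HasTowerCone G f ks) {ι : Type*} (l : List ι) (n : ι → ℤ) (u : ∀ i, G⟦n i⟧ ⟶ E') :
    ∃ (E'' : D) (g : E' ⟶ E'') (ls : List ℤ), (∀ i ∈ l, u i ≫ g = 0) ∧
      HasTowerCone G (f ≫ g) (ks ++ ls) ∧
        ∀ t, cost t ls = (l.map fun i => weight t (n i + 1)).sum := by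
  induction l with
  | nil => exact ⟨E', 𝟙 E', [], by simp, by simpa using hf, by simp⟩
  | cons i l ih =>
    obtain ⟨E₁, g, ls, hg, hc, hls⟩ := ih
    obtain ⟨E₂, g', hg', hc'⟩ := hc.exists_cone (u i ≫ g)
    refine ⟨E₂, g ≫ g', ls ++ [n i + 1], ?_, by simpa using hc', fun t => ?_⟩
    · intro j hj
      obtain rfl | hj := List.mem_cons.1 hj
      · simpa using hg'
      · rw [← Category.assoc, hg j hj, zero_comp]
    · rw [cost_append, hls, cost_singleton, List.map_cons, List.sum_cons, add_comm]

/-- Coning off bases of all `Hom(G[n], E')` gives a ghost, at a cost which is controlled by the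
graded dimension of the space of these morphisms. -/
lemma HasTowerCone.exists_ghost [IsTriangulated D] [∀ n : ℤ, (shiftFunctor D n).Linear k]
    (h : IsFiniteType k D) {G E E' : D} {f : E ⟶ E'} {ks : List ℤ}
    (hf : HasTowerCone G f ks) :
    ∃ (E'' : D) (g : E' ⟶ E'') (ls : List ℤ), ghost G g ∧ HasTowerCone G (f ≫ g) (ks ++ ls) ∧
      ∀ t, cost t ls ≤ weight t 1 * homSeries k t G E' := by
  let S := (h.finite_setOf_ne_zero G E').toFinset
  -- `Hom(G, E'[m])` is identified with `Hom(G[-m], E')`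
  let e : ∀ m : ℤ, (G ⟶ E'⟦m⟧) ≃ₗ[k] (G⟦-m⟧ ⟶ E') := fun m =>
    (LinearEquiv.ofBijective ((shiftFunctor D (-m)).mapLinearMap k (X := G) (Y := E'⟦m⟧))
      ⟨(shiftFunctor D (-m)).map_injective, (shiftFunctor D (-m)).map_surjective⟩).trans
      (Linear.homCongr k (Iso.refl _)
        ((shiftFunctorCompIsoId D m (-m) (add_neg_cancel m)).app E'))
  have := fun m => h.finite G E' m
  let b : ∀ m : ℤ, Module.Basis (Fin (homDim k G E' m)) k (G ⟶ E'⟦m⟧) :=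
    fun m => Module.finBasis k _
  let ι := Σ m : S, Fin (homDim k G E' m.1)
  obtain ⟨E'', g, ls, hg, hc, hls⟩ := hf.exists_cone_list (Finset.univ : Finset ι).toList
    (fun i => -i.1.1) (fun i => e i.1.1 (b i.1.1 i.2))
  refine ⟨E'', g, ls, ?_, hc, fun t => ?_⟩
  · have key : ∀ m : ℤ, (Linear.rightComp k (G⟦-m⟧) g) ∘ₗ (e m).toLinearMap = 0 := by
      intro m
      by_cases hm : m ∈ S
      · refine (b m).ext fun i => ?_
        exact hg ⟨⟨m, hm⟩, i⟩ (Finset.mem_toList.2 (Finset.mem_univ _))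
      · refine LinearMap.ext fun x => ?_
        have hx : x = 0 := by
          by_contra hx
          exact hm ((h.finite_setOf_ne_zero G E').mem_toFinset.2 ⟨x, hx⟩)
        rw [hx, map_zero, map_zero]
    intro n v
    obtain ⟨m, rfl⟩ : ∃ m, n = -m := ⟨-n, (neg_neg n).symm⟩
    have := LinearMap.congr_fun (key m) ((e m).symm v)
    simpa using this
  · rw [hls, Finset.sum_map_toList, Fintype.sum_sigma, homSeries, ← ENNReal.tsum_mul_left]
    refine le_trans ?_ (ENNReal.sum_le_tsum S)
    rw [← Finset.sum_coe_sort S]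
    refine Finset.sum_le_sum fun m _ => ?_
    simp only [Finset.sum_const, Finset.card_univ, Fintype.card_fin, nsmul_eq_mul]
    rw [add_comm, weight_add, mul_left_comm]

open scoped ZeroObject in
/-- Every object is the source of a composite of `n` ghosts whose cone is a tower, at a cost which
is linear in the graded dimension of the morphisms from `G`, with a constant `C t` which does not
depend on the object. -/
lemma exists_isComposite_ghost_hasTowerCone [IsTriangulated D]
    [∀ n : ℤ, (shiftFunctor D n).Linear k]
    (h : IsFiniteType k D) (G : D) (n : ℕ) : ∃ C : ℝ → ℝ≥0∞, (∀ t, C t ≠ ⊤) ∧ ∀ E : D,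
      ∃ (E' : D) (f : E ⟶ E') (ks : List ℤ), IsComposite (ghost G) n f ∧ HasTowerCone G f ks ∧
        ∀ t, cost t ks ≤ C t * homSeries k t G E := by
  induction n with
  | zero =>
    refine ⟨0, by simp, fun E => ⟨E, 𝟙 E, [], ⟨rfl, rfl⟩,
      ⟨0, 0, 0, contractible_distinguished E, .zero (isZero_zero D)⟩, by simp⟩⟩
  | succ n ih =>
    obtain ⟨C, hC, ih⟩ := ih
    refine ⟨fun t => C t + weight t 1 * (1 + C t * homSeries k t G G), fun t => ?_, fun E => ?_⟩
    · exact ENNReal.add_ne_top.2 ⟨hC t, ENNReal.mul_ne_top (weight_ne_top _ _)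
        (ENNReal.add_ne_top.2 ⟨by simp, ENNReal.mul_ne_top (hC t) (h.homSeries_ne_top t G G)⟩)⟩
    · obtain ⟨E', f, ks, hf, hc, hks⟩ := ih E
      obtain ⟨E'', g, ls, hg, hc', hls⟩ := hc.exists_ghost h
      refine ⟨E'', f ≫ g, ks ++ ls, hf.snoc hg, hc', fun t => ?_⟩
      obtain ⟨B, v, δ, hT, hB⟩ := hc
      have h1 : homSeries k t G E' ≤ homSeries k t G E + C t * homSeries k t G E *
          homSeries k t G G := by
        refine (h.homSeries_le_right t G hT).trans ?_
        gcongr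
        refine (hB.homSeries_le_right h t G).trans ?_
        gcongr
        exact hks t
      rw [cost_append]
      calc cost t ks + cost t ls
          ≤ C t * homSeries k t G E + weight t 1 * (homSeries k t G E + C t * homSeries k t G E *
              homSeries k t G G) := add_le_add (hks t) ((hls t).trans (by gcongr))
        _ = _ := by ring

/-- In a saturated category of finite type the complexity relative to a split generator is
bounded, up to a constant, by the graded dimension of the morphisms from the generator: by the
ghost lemma, an object is a direct summand of the tower obtained by killing these morphisms
finitely many times. -/
lemma exists_complexity_le_mul_homSeries [IsTriangulated D]
    [∀ n : ℤ, (shiftFunctor D n).Linear k] (hsat : IsSaturated.{w} k D) (h : IsFiniteType k D)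
    {G : D} (hG : IsSplitGenerator G) : ∃ C : ℝ → ℝ≥0∞, (∀ t, C t ≠ ⊤) ∧
      ∀ t E, complexity t G E ≤ C t * homSeries k t G E := by
  obtain ⟨n, hn⟩ := exists_isComposite_ghost_eq_zero hsat hG
  obtain ⟨C, hC, hCE⟩ := exists_isComposite_ghost_hasTowerCone h G n
  -- the tower is built for `E[-1]`, so that `E` itself is a summand of the cone
  refine ⟨fun t => C t * weight t (-1), fun t => ENNReal.mul_ne_top (hC t) (weight_ne_top _ _),
    fun t E => ?_⟩
  obtain ⟨E', f, ks, hf, ⟨B, v, δ, hT, hB⟩, hks⟩ := hCE (E⟦(-1 : ℤ)⟧)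
  obtain rfl := hn hf
  obtain ⟨e, -⟩ := exists_iso_binaryBiproduct_of_distTriang _ (rot_of_distTriang _ hT) (by
    change -(shiftFunctor D (1 : ℤ)).map _ = 0
    exact neg_eq_zero.2 ((shiftFunctor D (1 : ℤ)).map_zero _ _))
  let e' : B ≅ E ⊞ E' := e ≪≫ biprod.braiding _ _ ≪≫
    biprod.mapIso ((shiftFunctorCompIsoId D (-1 : ℤ) 1 (by simp)).app E) (Iso.refl E')
  refine (complexity_le_cost t hB e').trans ((hks t).trans_eq ?_)
  rw [homSeries_shift_right, mul_assoc]

end Triangulated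

/-! ### Hearts of bounded t-structures -/

section Triangulated

variable {D : Type u} [Category.{v} D] [Preadditive D]
  [HasZeroObject D] [HasShift D ℤ] [∀ n : ℤ, (shiftFunctor D n).Additive] [Pretriangulated D]
  {A : ObjectProperty D}

lemma IsBoundedHeart.hom_eq_zero_shift (hA : IsBoundedHeart A) {X Y : D} (hX : A X) (hY : A Y)
    {m p n q : ℤ} (h : n + q < m + p) (f : X⟦m⟧⟦p⟧ ⟶ Y⟦n⟧⟦q⟧) : f = 0 := by
  have h1 := hA.hom_eq_zero hX hY h ((shiftFunctorAdd D m p).hom.app X ≫ f ≫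
    (shiftFunctorAdd D n q).inv.app Y)
  have h2 := (cancel_epi ((shiftFunctorAdd D m p).hom.app X)).1 (h1.trans comp_zero.symm)
  exact (cancel_mono ((shiftFunctorAdd D n q).inv.app Y)).1 (h2.trans zero_comp.symm)

/-- There are no morphisms from `G[m]` to `E[n]` if all cohomology degrees of `G[m]` are larger
than those of `E[n]`. -/
lemma IsBoundedHeart.hom_eq_zero_of_filtration (hA : IsBoundedHeart A) {G E : D} {ks ls : List ℤ}
    (hG : IsCohomologyFiltration A G ks) (hE : IsCohomologyFiltration A E ls) {m n : ℤ}
    (h : ∀ p ∈ ks, ∀ q ∈ ls, q + n < p + m) (f : G⟦m⟧ ⟶ E⟦n⟧) : f = 0 := by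
  induction hG with
  | zero hG => exact ((shiftFunctor D m).map_isZero hG).eq_of_src _ _
  | @step G' G a ks p _ ha _ _ u w δ hT ih =>
    obtain ⟨f, rfl⟩ := yoneda_exact_shift hT m f (ih (fun p hp => h p (by simp [hp])) _)
    suffices f = 0 by rw [this, comp_zero]
    replace h : ∀ q ∈ ls, q + n < p + m := h p (by simp)
    clear ih
    induction hE with
    | zero hE => exact ((shiftFunctor D n).map_isZero hE).eq_of_tgt _ _
    | @step E' E b ls q _ hb _ _ u w δ hT' ih' =>
      obtain ⟨f, rfl⟩ := coyoneda_exact_shift hT' n f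
        (hA.hom_eq_zero_shift ha hb (h q (by simp)) _)
      rw [ih' f (fun q hq => h q (by simp [hq])), zero_comp]

lemma IsBoundedHeart.hom_eq_zero_of_filtration_left (hA : IsBoundedHeart A) {G E : D}
    {ks ls : List ℤ} (hG : IsCohomologyFiltration A G ks) (hE : IsCohomologyFiltration A E ls)
    {m : ℤ} (h : ∀ p ∈ ks, ∀ q ∈ ls, q < p + m) (f : G⟦m⟧ ⟶ E) : f = 0 :=
  (cancel_mono ((shiftFunctorZero D ℤ).inv.app E)).1
    ((hA.hom_eq_zero_of_filtration hG hE (fun p hp q hq => by simpa using h p hp q hq) _).trans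
      zero_comp.symm)

lemma IsBoundedHeart.hom_eq_zero_of_filtration_right (hA : IsBoundedHeart A) {G E : D}
    {ks ls : List ℤ} (hG : IsCohomologyFiltration A G ks) (hE : IsCohomologyFiltration A E ls)
    {n : ℤ} (h : ∀ p ∈ ks, ∀ q ∈ ls, q + n < p) (f : G ⟶ E⟦n⟧) : f = 0 :=
  (cancel_epi ((shiftFunctorZero D ℤ).hom.app G)).1
    ((hA.hom_eq_zero_of_filtration hG hE (fun p hp q hq => by simpa using h p hp q hq) _).trans
      comp_zero.symm)

open scoped ZeroObject in
lemma IsCohomologyFiltration.shift_of_heart {a : D} (ha : A a) (ha0 : ¬ IsZero a) (n : ℤ) :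
    IsCohomologyFiltration A (a⟦n⟧) [n] :=
  .step (ks := []) (.zero (isZero_zero D)) ha ha0 (by simp) 0 (𝟙 _) 0
    (contractible_distinguished₁ (a⟦n⟧))

lemma isZero_of_isZero_shift {D : Type*} [Category* D] [Preadditive D] [HasShift D ℤ]
    [∀ n : ℤ, (shiftFunctor D n).Additive] {X : D} {n : ℤ} (h : IsZero (X⟦n⟧)) : IsZero X := by
  refine (IsZero.iff_id_eq_zero X).2 ((Functor.map_eq_zero_iff (shiftFunctor D n)).1 ?_)
  exact h.eq_of_src _ _

lemma IsCohomologyFiltration.pairwise {E : D} {ks : List ℤ}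
    (h : IsCohomologyFiltration A E ks) : ks.Pairwise (· > ·) := by
  induction h with
  | zero => exact .nil
  | step _ _ _ hn _ _ _ _ ih =>
    refine List.pairwise_append.2 ⟨ih, List.pairwise_singleton _ _, ?_⟩
    intro m hm n hn'
    obtain rfl := List.mem_singleton.1 hn'
    exact hn m hm

lemma IsCohomologyFiltration.isZero {E : D} (h : IsCohomologyFiltration A E []) : IsZero E := by
  generalize hks : ([] : List ℤ) = ks at h
  cases h with
  | zero h => exact h
  | step => simp at hks

/-- The cohomology in the top degree maps nontrivially. -/
lemma IsBoundedHeart.exists_ne_zero_of_cons (hA : IsBoundedHeart A) {E : D} {n : ℤ} {ks : List ℤ}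
    (h : IsCohomologyFiltration A E (n :: ks)) :
    ∃ (Z : D) (f : Z ⟶ E), IsCohomologyFiltration A Z [n] ∧ f ≠ 0 := by
  generalize hls : n :: ks = ls at h
  induction h generalizing ks with
  | zero => simp at hls
  | @step E' E b ls m hE' hb hb0 hm u w δ hT ih =>
    obtain _ | ⟨n', ls⟩ := ls
    · obtain ⟨rfl, rfl⟩ : n = m ∧ ks = [] := by simpa using hls
      have : IsIso w := (Triangle.isZero₁_iff_isIso₂ _ hT).1 hE'.isZero
      refine ⟨b⟦n⟧, inv w, .shift_of_heart hb hb0 n, fun h0 => hb0 ?_⟩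
      exact isZero_of_isZero_shift (n := n) ((IsZero.iff_id_eq_zero _).2
        (by rw [← IsIso.inv_hom_id w, h0, zero_comp]))
    · obtain ⟨rfl, rfl⟩ : n = n' ∧ ks = ls ++ [m] := by simpa using hls
      obtain ⟨Z, f, hZ, hf⟩ := ih rfl
      refine ⟨Z, f ≫ u, hZ, fun h0 => hf ?_⟩
      obtain ⟨v, hv⟩ := Triangle.coyoneda_exact₁ _ hT (f⟦(1 : ℤ)⟧') (by
        change (f⟦(1 : ℤ)⟧') ≫ (u⟦(1 : ℤ)⟧') = 0
        rw [← Functor.map_comp, h0, Functor.map_zero])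
      have hmn := hm n (by simp)
      have hv0 : v = 0 := hA.hom_eq_zero_of_filtration_left hZ (.shift_of_heart hb hb0 m)
        (by simp; omega) v
      rw [hv0, zero_comp] at hv
      exact (Functor.map_eq_zero_iff _).1 hv

/-- The cohomology in the bottom degree receives a nontrivial morphism. -/
lemma IsBoundedHeart.exists_ne_zero_of_concat (hA : IsBoundedHeart A) {E : D} {n : ℤ}
    {ks : List ℤ} (h : IsCohomologyFiltration A E (ks ++ [n])) :
    ∃ (Z : D) (f : E ⟶ Z), IsCohomologyFiltration A Z [n] ∧ f ≠ 0 := by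
  generalize hls : ks ++ [n] = ls at h
  cases h with
  | zero => simp at hls
  | @step E' _ b ls m hE' hb hb0 hm u w δ hT =>
    obtain ⟨rfl, rfl⟩ : ks = ls ∧ n = m := by simpa using hls
    refine ⟨b⟦n⟧, w, .shift_of_heart hb hb0 n, fun hw => hb0 ?_⟩
    have : Mono δ := Triangle.mono₃ _ hT hw
    have := isSplitMono_of_mono δ
    have hr : retraction δ = 0 := hA.hom_eq_zero_of_filtration_left hE'
      (.shift_of_heart hb hb0 n) (fun p hp q hq => by
        have := hm p hp
        simp only [List.mem_singleton] at hq
        omega) _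
    refine isZero_of_isZero_shift (n := n) ((IsZero.iff_id_eq_zero _).2 ?_)
    rw [← IsSplitMono.id δ, hr, comp_zero]

lemma IsBoundedHeart.phiPlus_eq (hA : IsBoundedHeart A) {E : D} {n : ℤ} {ks : List ℤ}
    (h : IsCohomologyFiltration A E (n :: ks)) : phiPlus A E = n := by
  have key : ∀ {n n' : ℤ} {ks ks' : List ℤ}, IsCohomologyFiltration A E (n :: ks) →
      IsCohomologyFiltration A E (n' :: ks') → n ≤ n' := by
    intro n n' ks ks' h h'
    by_contra! hlt
    obtain ⟨Z, f, hZ, hf⟩ := hA.exists_ne_zero_of_cons h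
    refine hf ((cancel_epi ((shiftFunctorZero D ℤ).hom.app Z)).1
      ((hA.hom_eq_zero_of_filtration_left hZ h' ?_ _).trans comp_zero.symm))
    intro p hp q hq
    obtain rfl := List.mem_singleton.1 hp
    obtain rfl | hq := List.mem_cons.1 hq
    · omega
    · have := (List.pairwise_cons.1 h'.pairwise).1 q hq
      omega
  have : {n : ℤ | ∃ ks, IsCohomologyFiltration A E (n :: ks)} = {n} := by
    ext m
    exact ⟨fun ⟨ls, h'⟩ => le_antisymm (key h' h) (key h h'), by rintro rfl; exact ⟨ks, h⟩⟩
  rw [phiPlus, this, csSup_singleton]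

lemma IsBoundedHeart.phiMinus_eq (hA : IsBoundedHeart A) {E : D} {n : ℤ} {ks : List ℤ}
    (h : IsCohomologyFiltration A E (ks ++ [n])) : phiMinus A E = n := by
  have key : ∀ {n n' : ℤ} {ks ks' : List ℤ}, IsCohomologyFiltration A E (ks ++ [n]) →
      IsCohomologyFiltration A E (ks' ++ [n']) → n ≤ n' := by
    intro n n' ks ks' h h'
    by_contra! hlt
    obtain ⟨Z, f, hZ, hf⟩ := hA.exists_ne_zero_of_concat h'
    refine hf ((cancel_epi ((shiftFunctorZero D ℤ).hom.app E)).1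
      ((hA.hom_eq_zero_of_filtration_left h hZ ?_ _).trans comp_zero.symm))
    intro p hp q hq
    obtain rfl := List.mem_singleton.1 hq
    obtain hp | hp := List.mem_append.1 hp
    · have := (List.pairwise_append.1 h.pairwise).2.2 p hp n (List.mem_singleton_self n)
      omega
    · obtain rfl := List.mem_singleton.1 hp
      omega
  have : {n : ℤ | ∃ ks, IsCohomologyFiltration A E (ks ++ [n])} = {n} := by
    ext m
    exact ⟨fun ⟨ls, h'⟩ => le_antisymm (key h' h) (key h h'), by rintro rfl; exact ⟨ks, h⟩⟩
  rw [phiMinus, this, csInf_singleton]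

lemma IsBoundedHeart.exists_filtration' (hA : IsBoundedHeart A) (E : D) :
    ∃ ks, IsCohomologyFiltration A E ks := by
  by_cases hE : IsZero E
  · exact ⟨[], .zero hE⟩
  · exact hA.exists_filtration E hE

lemma IsBoundedHeart.exists_filtration_le_phiPlus (hA : IsBoundedHeart A) {E : D}
    (hE : ¬ IsZero E) : ∃ ks, IsCohomologyFiltration A E ks ∧ ∀ p ∈ ks, p ≤ phiPlus A E := by
  obtain ⟨ks, h⟩ := hA.exists_filtration E hE
  obtain _ | ⟨n, ks⟩ := ks
  · exact absurd h.isZero hE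
  refine ⟨n :: ks, h, fun p hp => ?_⟩
  rw [hA.phiPlus_eq h]
  obtain rfl | hp := List.mem_cons.1 hp
  · exact le_rfl
  · exact ((List.pairwise_cons.1 h.pairwise).1 p hp).le

lemma IsBoundedHeart.exists_filtration_phiMinus_mem (hA : IsBoundedHeart A) {E : D}
    (hE : ¬ IsZero E) : ∃ ks, IsCohomologyFiltration A E ks ∧ ∀ p ∈ ks, phiMinus A E ≤ p := by
  obtain ⟨ks, h⟩ := hA.exists_filtration E hE
  obtain rfl | ⟨ls, n, rfl⟩ := List.eq_nil_or_concat ks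
  · exact absurd h.isZero hE
  refine ⟨_, h, fun p hp => ?_⟩
  rw [List.concat_eq_append] at h hp
  rw [hA.phiMinus_eq h]
  obtain hp | hp := List.mem_append.1 hp
  · exact ((List.pairwise_append.1 h.pairwise).2.2 p hp n (List.mem_singleton_self n)).le
  · exact (List.mem_singleton.1 hp).ge

lemma IsBoundedHeart.exists_ne_zero_phiPlus (hA : IsBoundedHeart A) {E : D}
    (hE : ¬ IsZero E) :
    ∃ (Z : D) (f : Z ⟶ E), IsCohomologyFiltration A Z [phiPlus A E] ∧ f ≠ 0 := by
  obtain ⟨ks, h⟩ := hA.exists_filtration E hE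
  obtain _ | ⟨n, ks⟩ := ks
  · exact absurd h.isZero hE
  rw [hA.phiPlus_eq h]
  exact hA.exists_ne_zero_of_cons h

lemma IsBoundedHeart.exists_ne_zero_phiMinus (hA : IsBoundedHeart A) {E : D}
    (hE : ¬ IsZero E) :
    ∃ (Z : D) (f : E ⟶ Z), IsCohomologyFiltration A Z [phiMinus A E] ∧ f ≠ 0 := by
  obtain ⟨ks, h⟩ := hA.exists_filtration E hE
  obtain rfl | ⟨ls, n, rfl⟩ := List.eq_nil_or_concat ks
  · exact absurd h.isZero hE
  rw [List.concat_eq_append] at h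
  rw [hA.phiMinus_eq h]
  exact hA.exists_ne_zero_of_concat h

lemma exists_forall_mem_le (ks : List ℤ) : ∃ c : ℤ, ∀ p ∈ ks, p ≤ c := by
  obtain ⟨c, hc⟩ := ks.toFinset.finite_toSet.bddAbove
  exact ⟨c, fun p hp => hc (by simpa using hp)⟩

lemma exists_forall_le_mem (ks : List ℤ) : ∃ c : ℤ, ∀ p ∈ ks, c ≤ p := by
  obtain ⟨c, hc⟩ := ks.toFinset.finite_toSet.bddBelow
  exact ⟨c, fun p hp => hc (by simpa using hp)⟩

/-- If `Hom(X, E[-j]) ≠ 0` then `φ⁺(E)` is at least `j`, up to a constant. -/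
lemma IsBoundedHeart.exists_neg_le_phiPlus (hA : IsBoundedHeart A) (X : D) :
    ∃ c : ℤ, ∀ (E : D) (n : ℤ) (f : X ⟶ E⟦n⟧), f ≠ 0 → -n ≤ phiPlus A E + c := by
  obtain ⟨ks, hX⟩ := hA.exists_filtration' X
  obtain ⟨c, hc⟩ := exists_forall_le_mem ks
  refine ⟨-c, fun E n f hf => ?_⟩
  have hE : ¬ IsZero E := fun hE => hf (((shiftFunctor D n).map_isZero hE).eq_of_tgt _ _)
  obtain ⟨ls, hE, hls⟩ := hA.exists_filtration_le_phiPlus hE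
  by_contra! hlt
  refine hf (hA.hom_eq_zero_of_filtration_right hX hE (fun p hp q hq => ?_) f)
  have := hc p hp
  have := hls q hq
  omega

/-- If `Hom(E[n], Y) ≠ 0` then `φ⁻(E)` is at most `-n`, up to a constant. -/
lemma IsBoundedHeart.exists_phiMinus_le_neg (hA : IsBoundedHeart A) (Y : D) :
    ∃ c : ℤ, ∀ (E : D) (n : ℤ) (f : E⟦n⟧ ⟶ Y), f ≠ 0 → phiMinus A E ≤ -n + c := by
  obtain ⟨ks, hY⟩ := hA.exists_filtration' Y
  obtain ⟨c, hc⟩ := exists_forall_mem_le ks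
  refine ⟨c, fun E n f hf => ?_⟩
  have hE : ¬ IsZero E := fun hE => hf (((shiftFunctor D n).map_isZero hE).eq_of_src _ _)
  obtain ⟨ls, hE, hls⟩ := hA.exists_filtration_phiMinus_mem hE
  by_contra! hlt
  refine hf (hA.hom_eq_zero_of_filtration_left hE hY (fun p hp q hq => ?_) f)
  have := hc q hq
  have := hls p hp
  omega

lemma IsTower.hom_eq_zero_right {G A : D} {ks : List ℤ} (hA : IsTower G A ks) {Z : D}
    (h : ∀ n ∈ ks, ∀ f : Z ⟶ G⟦n⟧, f = 0) (f : Z ⟶ A) : f = 0 := by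
  induction hA with
  | zero hA => exact hA.eq_of_tgt _ _
  | step _ u w δ hT ih =>
    obtain ⟨g, rfl⟩ := Triangle.coyoneda_exact₂ _ hT f (h _ (by simp) _)
    exact (congrArg (· ≫ u) (ih (fun n hn => h n (by simp [hn])) g)).trans zero_comp

lemma IsTower.hom_eq_zero_left {G A : D} {ks : List ℤ} (hA : IsTower G A ks) {Z : D}
    (h : ∀ n ∈ ks, ∀ f : G⟦n⟧ ⟶ Z, f = 0) (f : A ⟶ Z) : f = 0 := by
  induction hA with
  | zero hA => exact hA.eq_of_src _ _
  | step _ u w δ hT ih =>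
    obtain ⟨g, rfl⟩ := Triangle.yoneda_exact₂ _ hT f (ih (fun n hn => h n (by simp [hn])) _)
    exact (congrArg (w ≫ ·) (h _ (by simp) g)).trans comp_zero

lemma weight_le_weight {t : ℝ} (ht : 0 ≤ t) {m n : ℤ} (h : m ≤ n) : weight t m ≤ weight t n :=
  ENNReal.ofReal_le_ofReal (Real.exp_le_exp.2
    (mul_le_mul_of_nonneg_right (by exact_mod_cast h) ht))

lemma weight_le_weight_of_nonpos {t : ℝ} (ht : t ≤ 0) {m n : ℤ} (h : n ≤ m) :
    weight t m ≤ weight t n :=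
  ENNReal.ofReal_le_ofReal (Real.exp_le_exp.2
    (mul_le_mul_of_nonpos_right (by exact_mod_cast h) ht))

/-- For `t ≥ 0`, the complexity of `E` is at least `e^(t φ⁺(E))`, up to a constant. -/
lemma IsBoundedHeart.exists_weight_phiPlus_le (hA : IsBoundedHeart A) {G : D}
    (hG : IsSplitGenerator G) : ∃ c : ℤ, ∀ (t : ℝ), 0 ≤ t → ∀ E : D, ¬ IsZero E →
      weight t (phiPlus A E) ≤ complexity t G E * weight t c := by
  obtain ⟨ls, hGls⟩ := hA.exists_filtration' G
  obtain ⟨c, hc⟩ := exists_forall_mem_le ls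
  refine ⟨c, fun t ht E hE => hG.le_complexity_mul t (weight_ne_top _ _) ?_⟩
  rintro B ks hB ⟨ρ⟩
  obtain ⟨Z, f, hZ, hf⟩ := hA.exists_ne_zero_phiPlus hE
  obtain ⟨n, hn, g, hg⟩ : ∃ n ∈ ks, ∃ g : Z ⟶ G⟦n⟧, g ≠ 0 := by
    by_contra! h0
    apply hf
    rw [← Category.comp_id f, ← ρ.retract, ← Category.assoc, hB.hom_eq_zero_right h0 (f ≫ ρ.i),
      zero_comp]
  have hle : phiPlus A E ≤ n + c := by
    by_contra! hlt
    refine hg (hA.hom_eq_zero_of_filtration_right hZ hGls (fun p hp q hq => ?_) g)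
    obtain rfl := List.mem_singleton.1 hp
    have := hc q hq
    omega
  refine (weight_le_weight ht hle).trans ?_
  rw [weight_add]
  gcongr
  exact weight_le_cost hn

/-- For `t ≤ 0`, the complexity of `E` is at least `e^(t φ⁻(E))`, up to a constant. -/
lemma IsBoundedHeart.exists_weight_phiMinus_le (hA : IsBoundedHeart A) {G : D}
    (hG : IsSplitGenerator G) : ∃ c : ℤ, ∀ (t : ℝ), t ≤ 0 → ∀ E : D, ¬ IsZero E →
      weight t (phiMinus A E) ≤ complexity t G E * weight t c := by
  obtain ⟨ls, hGls⟩ := hA.exists_filtration' G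
  obtain ⟨c, hc⟩ := exists_forall_le_mem ls
  refine ⟨c, fun t ht E hE => hG.le_complexity_mul t (weight_ne_top _ _) ?_⟩
  rintro B ks hB ⟨ρ⟩
  obtain ⟨Z, f, hZ, hf⟩ := hA.exists_ne_zero_phiMinus hE
  obtain ⟨n, hn, g, hg⟩ : ∃ n ∈ ks, ∃ g : G⟦n⟧ ⟶ Z, g ≠ 0 := by
    by_contra! h0
    apply hf
    rw [← Category.id_comp f, ← ρ.retract, Category.assoc, hB.hom_eq_zero_left h0 (ρ.r ≫ f),
      comp_zero]
  have hle : n + c ≤ phiMinus A E := by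
    by_contra! hlt
    refine hg (hA.hom_eq_zero_of_filtration_left hGls hZ (fun p hp q hq => ?_) g)
    obtain rfl := List.mem_singleton.1 hq
    have := hc p hp
    omega
  refine (weight_le_weight_of_nonpos ht hle).trans ?_
  rw [weight_add]
  gcongr
  exact weight_le_cost hn

/-- Serre duality: if `Hom(X, E[-j]) ≠ 0` then `φ⁻(E)` is at most `j`, up to a constant. -/
lemma IsBoundedHeart.exists_phiMinus_le_of_serreFunctor {k : Type uk} [Field k] [Linear k D]
    (S : SerreFunctor k D) (hA : IsBoundedHeart A) (X : D) :
    ∃ c : ℤ, ∀ (E : D) (n : ℤ) (f : X ⟶ E⟦n⟧), f ≠ 0 → phiMinus A E ≤ -n + c := by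
  obtain ⟨c, hc⟩ := hA.exists_phiMinus_le_neg (S.S.obj X)
  refine ⟨c, fun E n f hf => ?_⟩
  obtain ⟨g, hg⟩ : ∃ g : E⟦n⟧ ⟶ S.S.obj X, g ≠ 0 := by
    by_contra! h0
    apply hf
    apply (S.iso X (E⟦n⟧)).injective
    rw [map_zero]
    refine LinearMap.ext fun g => ?_
    rw [h0 g, map_zero, map_zero]
  exact hc E n g hg

end Triangulated

/-! ### Growth rates of families of sequences -/

/-- Fekete's lemma for a family of positive sequences which are submultiplicative up to constants;
the inequality `1 ≤ e t n * e (-t) n` keeps the growth rates away from `-∞`. -/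
lemma exists_tendsto_log_div {e : ℝ → ℕ → ℝ} {C : ℝ → ℝ} (hC : ∀ t, 0 < C t)
    (he : ∀ t n, 0 < e t n) (hmul : ∀ t m n, e t (m + n) ≤ C t * e t m * e t n)
    (hone : ∀ t n, 1 ≤ e t n * e (-t) n) :
    ∃ h : ℝ → ℝ, ∀ t, Tendsto (fun n : ℕ => Real.log (e t n) / n) atTop (𝓝 (h t)) := by
  have hlog : ∀ t n, Real.log (C t * e t n) = Real.log (C t) + Real.log (e t n) := fun t n =>
    Real.log_mul (hC t).ne' (he t n).ne'
  have hsub : ∀ t, Subadditive (fun n => Real.log (C t * e t n)) := by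
    intro t m n
    rw [← Real.log_mul (mul_pos (hC t) (he t m)).ne' (mul_pos (hC t) (he t n)).ne']
    refine Real.log_le_log (mul_pos (hC t) (he t _)) ?_
    calc C t * e t (m + n) ≤ C t * (C t * e t m * e t n) :=
          mul_le_mul_of_nonneg_left (hmul t m n) (hC t).le
      _ = _ := by ring
  have hbdd : ∀ t, BddBelow (Set.range fun n : ℕ => Real.log (C t * e t n) / n) := by
    intro t
    set u : ℕ → ℝ := fun n => Real.log (C (-t) * e (-t) n) with hu
    set B : ℝ := |Real.log (C t) + Real.log (C (-t))| + |u 1| + |u 0|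
    refine ⟨-B, ?_⟩
    rintro _ ⟨n, rfl⟩
    obtain rfl | hn := Nat.eq_zero_or_pos n
    · have : 0 ≤ B := by positivity
      simpa using this
    have hn' : (1 : ℝ) ≤ n := by exact_mod_cast hn
    have h1 : u n ≤ n * u 1 + u 0 := by
      have := (hsub (-t)).apply_mul_add_le n 1 0
      simpa using this
    have h2 : 0 ≤ Real.log (e t n) + Real.log (e (-t) n) := by
      rw [← Real.log_mul (he t n).ne' (he (-t) n).ne']
      exact Real.log_nonneg (hone t n)
    have h3 : u n = Real.log (C (-t)) + Real.log (e (-t) n) := hlog _ _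
    rw [le_div_iff₀ (by linarith), hlog]
    have h4 := neg_abs_le (Real.log (C t) + Real.log (C (-t)))
    have h5 := le_abs_self (u 1)
    have h6 := le_abs_self (u 0)
    have h7 : (n : ℝ) * u 1 ≤ n * |u 1| := by gcongr
    have h8 : |Real.log (C t) + Real.log (C (-t))| ≤
        n * |Real.log (C t) + Real.log (C (-t))| := le_mul_of_one_le_left (abs_nonneg _) hn'
    have h9 : |u 0| ≤ n * |u 0| := le_mul_of_one_le_left (abs_nonneg _) hn'
    simp only [B]
    nlinarith
  refine ⟨fun t => (hsub t).lim, fun t => ?_⟩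
  have h1 := (hsub t).tendsto_lim (hbdd t)
  have h2 := tendsto_const_div_atTop_nhds_zero_nat (Real.log (C t))
  have h3 := h1.sub h2
  rw [sub_zero] at h3
  refine h3.congr fun n => ?_
  rw [hlog]
  ring

/-- If `a t n` is `t * p n` up to an error which is independent of `t`, then the growth rate `h t`
of `a t` is asymptotically linear in `t`, and its slope is the growth rate of `p`. -/
lemma exists_tendsto_slope {a : ℝ → ℕ → ℝ} {h : ℝ → ℝ} {p : ℕ → ℝ}
    (ha : ∀ t, 0 ≤ t → Tendsto (fun n : ℕ => a t n / n) atTop (𝓝 (h t)))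
    (h₁ : ∀ t, 0 ≤ t → ∀ n, t * p n ≤ a t n)
    (h₂ : ∀ t, 0 ≤ t → ∀ n, a t n ≤ a 0 n + t * p n) :
    ∃ τ : ℝ, Tendsto (fun t => h t / t) atTop (𝓝 τ) ∧
      Tendsto (fun n : ℕ => p n / n) atTop (𝓝 τ) := by
  have hp₁ : ∀ t, 0 < t → ∀ n : ℕ, p n / n ≤ a t n / n / t := by
    intro t ht n
    rw [le_div_iff₀ ht, div_mul_eq_mul_div, mul_comm]
    exact div_le_div_of_nonneg_right (h₁ t ht.le n) (Nat.cast_nonneg n)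
  have hp₂ : ∀ t, 0 < t → ∀ n : ℕ, (a t n / n - a 0 n / n) / t ≤ p n / n := by
    intro t ht n
    rw [div_le_iff₀ ht, ← sub_div, div_mul_eq_mul_div, mul_comm]
    exact div_le_div_of_nonneg_right (by linarith [h₂ t ht.le n]) (Nat.cast_nonneg n)
  have hlim : ∀ t, 0 < t →
      Tendsto (fun n : ℕ => (a t n / n - a 0 n / n) / t) atTop (𝓝 ((h t - h 0) / t)) :=
    fun t ht => ((ha t ht.le).sub (ha 0 le_rfl)).div_const t
  have hlim' : ∀ t, 0 < t → Tendsto (fun n : ℕ => a t n / n / t) atTop (𝓝 (h t / t)) :=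
    fun t ht => (ha t ht.le).div_const t
  have hst : ∀ s t, 0 < s → 0 < t → (h t - h 0) / t ≤ h s / s := fun s t hs ht =>
    le_of_tendsto_of_tendsto' (hlim t ht) (hlim' s hs) fun n => (hp₂ t ht n).trans (hp₁ s hs n)
  let S : Set ℝ := (fun s => h s / s) '' Set.Ioi 0
  have hS : BddBelow S := ⟨(h 1 - h 0) / 1, by
    rintro _ ⟨s, hs, rfl⟩
    exact hst s 1 hs one_pos⟩
  have hne : S.Nonempty := ⟨_, 1, Set.mem_Ioi.2 one_pos, rfl⟩
  have hτ₁ : ∀ t, 0 < t → sInf S ≤ h t / t := fun t ht => csInf_le hS ⟨t, ht, rfl⟩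
  have hτ₂ : ∀ t, 0 < t → (h t - h 0) / t ≤ sInf S := fun t ht => le_csInf hne (by
    rintro _ ⟨s, hs, rfl⟩
    exact hst s t hs ht)
  have hT : Tendsto (fun t => h t / t) atTop (𝓝 (sInf S)) := by
    have h0 : Tendsto (fun t : ℝ => sInf S + h 0 / t) atTop (𝓝 (sInf S + 0)) :=
      tendsto_const_nhds.add (tendsto_const_nhds.div_atTop tendsto_id)
    rw [add_zero] at h0
    refine tendsto_of_tendsto_of_tendsto_of_le_of_le' tendsto_const_nhds h0 ?_ ?_
    · filter_upwards [eventually_gt_atTop 0] with t ht using hτ₁ t ht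
    · filter_upwards [eventually_gt_atTop 0] with t ht
      have := hτ₂ t ht
      rw [sub_div] at this
      linarith
  refine ⟨sInf S, hT, tendsto_order.2 ⟨fun l hl => ?_, fun l hl => ?_⟩⟩
  · have h0 : Tendsto (fun t : ℝ => (h t - h 0) / t) atTop (𝓝 (sInf S - 0)) := by
      simp only [sub_div]
      exact hT.sub (tendsto_const_nhds.div_atTop tendsto_id)
    rw [sub_zero] at h0
    obtain ⟨t, ht, ht0⟩ := ((h0.eventually_const_lt hl).and (eventually_gt_atTop 0)).exists
    filter_upwards [(hlim t ht0).eventually_const_lt ht] with n hn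
    exact hn.trans_le (hp₂ t ht0 n)
  · obtain ⟨t, ht, ht0⟩ := ((hT.eventually_lt_const hl).and (eventually_gt_atTop 0)).exists
    filter_upwards [(hlim' t ht0).eventually_lt_const ht] with n hn
    exact (hp₁ t ht0 n).trans_lt hn

/-- In the situation of `exists_tendsto_slope`, a sequence `y` which is bounded below by `p` and
for which `t * y n` is bounded above by `a t n`, both up to constants, has the same growth rate
as `p`. -/
lemma tendsto_div_of_le_of_slope {a : ℝ → ℕ → ℝ} {h : ℝ → ℝ} {p y : ℕ → ℝ} {τ c : ℝ}
    (ha : ∀ t, 0 ≤ t → Tendsto (fun n : ℕ => a t n / n) atTop (𝓝 (h t)))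
    (hh : Tendsto (fun t => h t / t) atTop (𝓝 τ))
    (hp : Tendsto (fun n : ℕ => p n / n) atTop (𝓝 τ)) (h₁ : ∀ n, p n ≤ y n + c)
    (h₂ : ∀ t, 0 ≤ t → ∃ K, ∀ n, t * y n ≤ a t n + K) :
    Tendsto (fun n : ℕ => y n / n) atTop (𝓝 τ) := by
  refine tendsto_order.2 ⟨fun l hl => ?_, fun l hl => ?_⟩
  · have h0 := hp.sub (tendsto_const_div_atTop_nhds_zero_nat c)
    rw [sub_zero] at h0
    filter_upwards [h0.eventually_const_lt hl] with n hn
    refine hn.trans_le ?_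
    rw [← sub_div]
    exact div_le_div_of_nonneg_right (by linarith [h₁ n]) (Nat.cast_nonneg n)
  · obtain ⟨t, ht, ht0⟩ := ((hh.eventually_lt_const hl).and (eventually_gt_atTop 0)).exists
    obtain ⟨K, hK⟩ := h₂ t ht0.le
    have h0 := ((ha t ht0.le).add (tendsto_const_div_atTop_nhds_zero_nat K)).div_const t
    rw [add_zero] at h0
    filter_upwards [h0.eventually_lt_const ht] with n hn
    refine lt_of_le_of_lt ?_ hn
    rw [le_div_iff₀ ht0, ← add_div, div_mul_eq_mul_div, mul_comm]
    exact div_le_div_of_nonneg_right (hK n) (Nat.cast_nonneg n)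

/-- Logarithmic growth rates only depend on a sequence up to bounded factors. -/
lemma tendsto_log_div_of_le_mul {c e : ℕ → ℝ≥0∞} {K L : ℝ≥0∞} {x : ℝ} (he0 : ∀ n, e n ≠ 0)
    (het : ∀ n, e n ≠ ⊤) (hK : K ≠ ⊤) (hL : L ≠ ⊤) (h₁ : ∀ n, c n ≤ K * e n)
    (h₂ : ∀ n, e n ≤ L * c n)
    (h : Tendsto (fun n : ℕ => Real.log (e n).toReal / n) atTop (𝓝 x)) :
    Tendsto (fun n : ℕ => Real.log (c n).toReal / n) atTop (𝓝 x) := by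
  have hc0 : ∀ n, c n ≠ 0 := fun n h0 => he0 n (by simpa [h0] using h₂ n)
  have hct : ∀ n, c n ≠ ⊤ := fun n => ne_top_of_le_ne_top (ENNReal.mul_ne_top hK (het n)) (h₁ n)
  have hK0 : K ≠ 0 := by rintro rfl; exact hc0 0 (by simpa using h₁ 0)
  have hL0 : L ≠ 0 := by rintro rfl; exact he0 0 (by simpa using h₂ 0)
  have key : ∀ {a b M : ℝ≥0∞}, a ≠ 0 → b ≠ 0 → M ≠ 0 → a ≠ ⊤ → b ≠ ⊤ → M ≠ ⊤ → a ≤ M * b →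
      Real.log a.toReal ≤ Real.log M.toReal + Real.log b.toReal := by
    intro a b M ha hb hM ha' hb' hM' hle
    rw [← Real.log_mul (ENNReal.toReal_ne_zero.2 ⟨hM, hM'⟩) (ENNReal.toReal_ne_zero.2 ⟨hb, hb'⟩),
      ← ENNReal.toReal_mul]
    exact Real.log_le_log (ENNReal.toReal_pos ha ha')
      (ENNReal.toReal_mono (ENNReal.mul_ne_top hM' hb') hle)
  have hu := (tendsto_const_div_atTop_nhds_zero_nat (Real.log K.toReal)).add h
  have hl := h.sub (tendsto_const_div_atTop_nhds_zero_nat (Real.log L.toReal))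
  rw [zero_add] at hu
  rw [sub_zero] at hl
  refine tendsto_of_tendsto_of_tendsto_of_le_of_le hl hu (fun n => ?_) (fun n => ?_)
  · simp only
    rw [← sub_div]
    refine div_le_div_of_nonneg_right ?_ (Nat.cast_nonneg n)
    linarith [key (he0 n) (hc0 n) hL0 (het n) (hct n) hL (h₂ n)]
  · simp only
    rw [← add_div]
    exact div_le_div_of_nonneg_right (key (hc0 n) (he0 n) hK0 (hct n) (het n) hK (h₁ n))
      (Nat.cast_nonneg n)

lemma tendsto_ennreal_log_div {c : ℕ → ℝ≥0∞} {x : ℝ} (hc0 : ∀ n, c n ≠ 0) (hct : ∀ n, c n ≠ ⊤)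
    (h : Tendsto (fun n : ℕ => Real.log (c n).toReal / n) atTop (𝓝 x)) :
    Tendsto (fun n : ℕ => ENNReal.log (c n) / ((n : ℝ) : EReal)) atTop (𝓝 (x : EReal)) := by
  refine ((continuous_coe_real_ereal.tendsto x).comp h).congr fun n => ?_
  rw [ENNReal.log_pos_real (hc0 n) (hct n), ← EReal.coe_div]
  rfl

/-! ### Entropy and shifting numbers -/

section Triangulated

variable {k : Type uk} [Field k] {D : Type u} [Category.{v} D] [Preadditive D] [Linear k D]
  [HasZeroObject D] [HasShift D ℤ] [∀ n : ℤ, (shiftFunctor D n).Additive]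
  [Pretriangulated D]

lemma log_toReal_weight (t : ℝ) (n : ℤ) : Real.log (weight t n).toReal = n * t := by
  rw [weight, ENNReal.toReal_ofReal (Real.exp_nonneg _), Real.log_exp]

lemma log_toReal_le_log_toReal {a b : ℝ≥0∞} (ha : a ≠ 0) (hb : b ≠ ⊤) (hab : a ≤ b) :
    Real.log a.toReal ≤ Real.log b.toReal :=
  Real.log_le_log (ENNReal.toReal_pos ha (ne_top_of_le_ne_top hb hab)) (ENNReal.toReal_mono hb hab)

lemma log_toReal_mul {a b : ℝ≥0∞} (ha : a ≠ 0) (ha' : a ≠ ⊤) (hb : b ≠ 0) (hb' : b ≠ ⊤) :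
    Real.log (a * b).toReal = Real.log a.toReal + Real.log b.toReal := by
  rw [ENNReal.toReal_mul, Real.log_mul (ENNReal.toReal_ne_zero.2 ⟨ha, ha'⟩)
    (ENNReal.toReal_ne_zero.2 ⟨hb, hb'⟩)]

lemma mul_le_log_homSeries_add {t : ℝ} {G E : D} {C : ℝ≥0∞} (hC : C ≠ ⊤)
    (hCE : complexity t G E ≤ C * homSeries k t G E)
    (ht : homSeries k t G E ≠ ⊤) {m c : ℤ} (hm : weight t m ≤ complexity t G E * weight t c) :
    m * t ≤ Real.log (homSeries k t G E).toReal + (Real.log C.toReal + c * t) := by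
  have h1 : weight t m ≤ C * homSeries k t G E * weight t c := hm.trans (by gcongr)
  have h0 : C * homSeries k t G E ≠ 0 := by
    intro h0
    rw [h0, zero_mul] at h1
    exact weight_ne_zero t m (le_antisymm h1 zero_le)
  have hC0 : C ≠ 0 := left_ne_zero_of_mul h0
  have h0' : homSeries k t G E ≠ 0 := right_ne_zero_of_mul h0
  have h2 := log_toReal_le_log_toReal (weight_ne_zero t m)
    (ENNReal.mul_ne_top (ENNReal.mul_ne_top hC ht) (weight_ne_top t c)) h1
  rw [log_toReal_mul h0 (ENNReal.mul_ne_top hC ht) (weight_ne_zero _ _) (weight_ne_top _ _),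
    log_toReal_mul hC0 hC h0' ht, log_toReal_weight, log_toReal_weight] at h2
  linarith

lemma NotVirtuallyZero.not_isZero_iterate {F : D ⥤ D} [F.CommShift ℤ] [F.IsTriangulated]
    (hF : NotVirtuallyZero F) (h : IsFiniteType k D) {G : D} (hG : IsSplitGenerator G) (n : ℕ) :
    ¬ IsZero (F.obj^[n] G) := by
  intro h0
  obtain ⟨X, hX⟩ := hF n
  have h1 := (h.one_le_homSeries_self 0 hX).trans
    (hG.homSeries_iterate_le h F 0 (F.obj^[n] X) X n)
  rw [homSeries_eq_zero_right h0] at h1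
  simp at h1

variable [∀ n : ℤ, (shiftFunctor D n).Linear k]

lemma IsSplitGenerator.exists_ne_zero {G : D} (hG : IsSplitGenerator G) (h : IsFiniteType k D)
    {E : D} (hE : ¬ IsZero E) : ∃ (n : ℤ) (f : G ⟶ E⟦n⟧), f ≠ 0 := by
  by_contra! h0
  have h1 : homSeries k 0 G E = 0 :=
    ENNReal.tsum_eq_zero.2 fun n => by simp [h.homDim_eq_zero_iff.2 (h0 n)]
  have h2 := (h.one_le_homSeries_self 0 hE).trans (hG.homSeries_le_complexity_mul_left h 0 E E)
  simp [h1] at h2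

lemma IsSplitGenerator.homSeries_ne_zero {G : D} (hG : IsSplitGenerator G) (h : IsFiniteType k D)
    (t : ℝ) {E : D} (hE : ¬ IsZero E) : homSeries k t G E ≠ 0 := by
  obtain ⟨n, f, hf⟩ := hG.exists_ne_zero h hE
  intro h0
  have h1 := h.weight_le_homSeries t hf
  rw [h0] at h1
  exact weight_ne_zero t (-n) (le_antisymm h1 zero_le)

lemma IsSplitGenerator.one_le_homSeries_mul {G : D} (hG : IsSplitGenerator G)
    (h : IsFiniteType k D) (t : ℝ) {E : D} (hE : ¬ IsZero E) :
    1 ≤ homSeries k t G E * homSeries k (-t) G E := by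
  obtain ⟨n, f, hf⟩ := hG.exists_ne_zero h hE
  calc (1 : ℝ≥0∞) = weight t (-n) * weight (-t) (-n) := by
        rw [weight_neg_left, ← weight_add]; simp
    _ ≤ _ := mul_le_mul' (h.weight_le_homSeries t hf) (h.weight_le_homSeries (-t) hf)

/-- For `t ≥ 0`, the series of `Hom(G, E)` is dominated by its value at `t = 0` times `e^(j t)`,
where `j = -n` is the largest number with `Hom(G, E[-j]) ≠ 0`. -/
lemma IsSplitGenerator.exists_homSeries_le_of_nonneg {G : D} (hG : IsSplitGenerator G)
    (h : IsFiniteType k D) {E : D} (hE : ¬ IsZero E) :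
    ∃ (n : ℤ) (f : G ⟶ E⟦n⟧), f ≠ 0 ∧
      ∀ t, 0 ≤ t → homSeries k t G E ≤ homSeries k 0 G E * weight t (-n) := by
  obtain ⟨n, ⟨f, hf⟩, hn⟩ := Set.exists_min_image _ id (h.finite_setOf_ne_zero G E)
    (hG.exists_ne_zero h hE)
  refine ⟨n, f, hf, fun t ht => ?_⟩
  rw [homSeries, homSeries, ← ENNReal.tsum_mul_right]
  refine ENNReal.tsum_le_tsum fun m => ?_
  by_cases hm : ∀ g : G ⟶ E⟦m⟧, g = 0
  · simp [h.homDim_eq_zero_iff.2 hm]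
  push Not at hm
  have hle := weight_le_weight ht (neg_le_neg (hn m hm))
  have h0 : weight 0 (-m) = 1 := by simp [weight]
  rw [h0, mul_one]
  gcongr
  exact hle

/-- For `t ≤ 0`, the series of `Hom(G, E)` is dominated by its value at `t = 0` times `e^(j t)`,
where `j = -n` is the smallest number with `Hom(G, E[-j]) ≠ 0`. -/
lemma IsSplitGenerator.exists_homSeries_le_of_nonpos {G : D} (hG : IsSplitGenerator G)
    (h : IsFiniteType k D) {E : D} (hE : ¬ IsZero E) :
    ∃ (n : ℤ) (f : G ⟶ E⟦n⟧), f ≠ 0 ∧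
      ∀ t, t ≤ 0 → homSeries k t G E ≤ homSeries k 0 G E * weight t (-n) := by
  obtain ⟨n, ⟨f, hf⟩, hn⟩ := Set.exists_max_image _ id (h.finite_setOf_ne_zero G E)
    (hG.exists_ne_zero h hE)
  refine ⟨n, f, hf, fun t ht => ?_⟩
  rw [homSeries, homSeries, ← ENNReal.tsum_mul_right]
  refine ENNReal.tsum_le_tsum fun m => ?_
  by_cases hm : ∀ g : G ⟶ E⟦m⟧, g = 0
  · simp [h.homDim_eq_zero_iff.2 hm]
  push Not at hm
  have hle := weight_le_weight_of_nonpos ht (neg_le_neg (hn m hm))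
  have h0 : weight 0 (-m) = 1 := by simp [weight]
  rw [h0, mul_one]
  gcongr
  exact hle

variable (F : D ⥤ D) [F.CommShift ℤ] [F.IsTriangulated]

/-- The entropy function exists, and it is the growth rate of the graded dimensions of
`Hom(G, Fⁿ G)`. -/
lemma exists_isEntropyFunction [IsTriangulated D] (hsat : IsSaturated.{w} k D)
    (h : IsFiniteType k D) (hgen : ∃ G : D, IsSplitGenerator G) (hF : NotVirtuallyZero F) :
    ∃ φ : ℝ → ℝ, IsEntropyFunction F φ ∧ ∀ G : D, IsSplitGenerator G → ∀ t,
      Tendsto (fun n : ℕ => Real.log (homSeries k t G (F.obj^[n] G)).toReal / n) atTop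
        (𝓝 (φ t)) := by
  obtain ⟨G, hG⟩ := hgen
  have hnz : ∀ {G : D}, IsSplitGenerator G → ∀ t n, homSeries k t G (F.obj^[n] G) ≠ 0 :=
    fun hG t n => hG.homSeries_ne_zero h t (hF.not_isZero_iterate h hG n)
  have hnt : ∀ (G : D) t n, homSeries k t G (F.obj^[n] G) ≠ ⊤ :=
    fun G t n => h.homSeries_ne_top t G _
  obtain ⟨C, hC, hCE⟩ := exists_complexity_le_mul_homSeries hsat h hG
  have hC0 : ∀ t, C t ≠ 0 := by
    intro t h0
    have h1 := hCE t (F.obj^[0] G)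
    have h2 := hG.homSeries_le_complexity_mul h t G (F.obj^[0] G)
    rw [h0, zero_mul, nonpos_iff_eq_zero] at h1
    rw [h1, zero_mul, nonpos_iff_eq_zero] at h2
    exact hnz hG t 0 h2
  obtain ⟨φ, hφ⟩ := exists_tendsto_log_div
    (e := fun t n => (homSeries k t G (F.obj^[n] G)).toReal) (C := fun t => (C t).toReal)
    (fun t => ENNReal.toReal_pos (hC0 t) (hC t))
    (fun t n => ENNReal.toReal_pos (hnz hG t n) (hnt G t n))
    (fun t m n => by
      rw [← ENNReal.toReal_mul, ← ENNReal.toReal_mul]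
      refine ENNReal.toReal_mono
        (ENNReal.mul_ne_top (ENNReal.mul_ne_top (hC t) (hnt G t m)) (hnt G t n)) ?_
      rw [Function.iterate_add_apply]
      calc homSeries k t G (F.obj^[m] (F.obj^[n] G))
          ≤ complexity t G (F.obj^[n] G) * homSeries k t G (F.obj^[m] G) :=
            hG.homSeries_iterate_le h F t G _ m
        _ ≤ C t * homSeries k t G (F.obj^[n] G) * homSeries k t G (F.obj^[m] G) := by
            gcongr
            exact hCE t _
        _ = _ := by ring)
    (fun t n => by
      rw [← ENNReal.toReal_mul, ← ENNReal.toReal_one]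
      exact ENNReal.toReal_mono (ENNReal.mul_ne_top (hnt G t n) (hnt G (-t) n))
        (hG.one_le_homSeries_mul h t (hF.not_isZero_iterate h hG n)))
  have hchange : ∀ {G₁ G₂ : D}, IsSplitGenerator G₁ → IsSplitGenerator G₂ → ∀ t n,
      homSeries k t G₁ (F.obj^[n] G₁) ≤ (complexity (-t) G₂ G₁ * complexity t G₂ G₁) *
        homSeries k t G₂ (F.obj^[n] G₂) := by
    intro G₁ G₂ hG₁ hG₂ t n
    calc homSeries k t G₁ (F.obj^[n] G₁)
        ≤ complexity (-t) G₂ G₁ * homSeries k t G₂ (F.obj^[n] G₁) :=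
          hG₂.homSeries_le_complexity_mul_left h t _ _
      _ ≤ complexity (-t) G₂ G₁ * (complexity t G₂ G₁ * homSeries k t G₂ (F.obj^[n] G₂)) := by
          gcongr
          exact hG₂.homSeries_iterate_le h F t G₂ G₁ n
      _ = _ := by ring
  have hφ' : ∀ G : D, IsSplitGenerator G → ∀ t,
      Tendsto (fun n : ℕ => Real.log (homSeries k t G (F.obj^[n] G)).toReal / n) atTop
        (𝓝 (φ t)) := fun G' hG' t =>
    tendsto_log_div_of_le_mul (hnz hG t) (hnt G t)
      (ENNReal.mul_ne_top (hG (-t) G').ne (hG t G').ne)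
      (ENNReal.mul_ne_top (hG' (-t) G).ne (hG' t G).ne)
      (hchange hG' hG t) (hchange hG hG' t) (hφ t)
  refine ⟨φ, fun G hG t => ?_, hφ'⟩
  obtain ⟨C, hC, hCE⟩ := exists_complexity_le_mul_homSeries hsat h hG
  have h2 : ∀ n, homSeries k t G (F.obj^[n] G) ≤
      homSeries k t G G * complexity t G (F.obj^[n] G) := fun n =>
    (hG.homSeries_le_complexity_mul h t G _).trans_eq (mul_comm _ _)
  refine tendsto_ennreal_log_div (fun n h0 => hnz hG t n ?_) (fun n => (hG t _).ne)
    (tendsto_log_div_of_le_mul (hnz hG t) (hnt G t) (hC t) (h.homSeries_ne_top t G G)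
      (fun n => hCE t _) h2 (hφ' G hG t))
  simpa [h0] using h2 n

end Triangulated

end ShiftingNumbers

end

theorem theorem2p1 (k : Type uk) [Field k] (D : Type u) [Category.{v} D]
    [Preadditive D] [Linear k D] [HasZeroObject D] [HasShift D ℤ]
    [∀ n : ℤ, (shiftFunctor D n).Additive] [∀ n : ℤ, (shiftFunctor D n).Linear k]
    [Pretriangulated D] [IsTriangulated D]
    (hsat : ShiftingNumbers.IsSaturated.{w} k D) (hft : ShiftingNumbers.IsFiniteType k D)
    (hgen : ∃ G : D, ShiftingNumbers.IsSplitGenerator G)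
    (F : D ⥤ D) [F.CommShift ℤ] [F.IsTriangulated] [F.Additive] [F.Linear k]
    (hF : ShiftingNumbers.NotVirtuallyZero F) :
    (∃ τ : ℝ, ShiftingNumbers.IsUpperShiftingNumber F τ ∧
      ∀ (G : D) (A : ObjectProperty D), ShiftingNumbers.IsSplitGenerator G →
        ShiftingNumbers.IsBoundedHeart A →
        Tendsto (fun n : ℕ => (ShiftingNumbers.phiPlus A (F.obj^[n] G) : ℝ) / n) atTop (𝓝 τ)) ∧
    (Nonempty (ShiftingNumbers.SerreFunctor k D) →
      ∃ τ : ℝ, ShiftingNumbers.IsLowerShiftingNumber F τ ∧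
        ∀ (G : D) (A : ObjectProperty D), ShiftingNumbers.IsSplitGenerator G →
          ShiftingNumbers.IsBoundedHeart A →
          Tendsto (fun n : ℕ => (ShiftingNumbers.phiMinus A (F.obj^[n] G) : ℝ) / n) atTop
            (𝓝 τ)) := by
  open ShiftingNumbers in
  obtain ⟨φ, hφ, hφ'⟩ := exists_isEntropyFunction F hsat hft hgen hF
  have hnz : ∀ {G : D}, IsSplitGenerator G → ∀ t n, homSeries k t G (F.obj^[n] G) ≠ 0 :=
    fun hG t n => hG.homSeries_ne_zero hft t (hF.not_isZero_iterate hft hG n)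
  have hnt : ∀ (G : D) t n, homSeries k t G (F.obj^[n] G) ≠ ⊤ :=
    fun G t n => hft.homSeries_ne_top t G _
  have hle : ∀ {G : D} {t : ℝ} {n : ℕ} {m : ℤ} {f : G ⟶ (F.obj^[n] G)⟦m⟧}, f ≠ 0 →
      -m * t ≤ Real.log (homSeries k t G (F.obj^[n] G)).toReal := by
    intro G t n m f hf
    have := log_toReal_le_log_toReal (weight_ne_zero t (-m)) (hnt G t n)
      (hft.weight_le_homSeries t hf)
    rw [log_toReal_weight] at this
    exact_mod_cast this
  have hge : ∀ {G : D} {t : ℝ} {n : ℕ} {m : ℤ}, IsSplitGenerator G →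
      homSeries k t G (F.obj^[n] G) ≤ homSeries k 0 G (F.obj^[n] G) * weight t (-m) →
      Real.log (homSeries k t G (F.obj^[n] G)).toReal ≤
        Real.log (homSeries k 0 G (F.obj^[n] G)).toReal + -m * t := by
    intro G t n m hG h
    have := log_toReal_le_log_toReal (hnz hG t n)
      (ENNReal.mul_ne_top (hnt G 0 n) (weight_ne_top t (-m))) h
    rw [log_toReal_mul (hnz hG 0 n) (hnt G 0 n) (weight_ne_zero _ _) (weight_ne_top _ _),
      log_toReal_weight] at this
    exact_mod_cast this
  constructor
  · have key : ∀ G : D, IsSplitGenerator G → ∃ (p : ℕ → ℤ) (f : ∀ n, G ⟶ (F.obj^[n] G)⟦p n⟧),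
        (∀ n, f n ≠ 0) ∧ ∃ τ : ℝ, Tendsto (fun t => φ t / t) atTop (𝓝 τ) ∧
          Tendsto (fun n : ℕ => (-p n : ℝ) / n) atTop (𝓝 τ) := by
      intro G hG
      choose p f hf hp using fun n =>
        hG.exists_homSeries_le_of_nonneg hft (hF.not_isZero_iterate hft hG n)
      refine ⟨p, f, hf, exists_tendsto_slope
        (a := fun t n => Real.log (homSeries k t G (F.obj^[n] G)).toReal)
        (fun t _ => hφ' G hG t) (fun t _ n => ?_) (fun t ht n => ?_)⟩
      · rw [mul_comm]
        exact hle (hf n)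
      · rw [mul_comm t]
        exact hge hG (hp n t ht)
    obtain ⟨G₀, hG₀⟩ := hgen
    obtain ⟨-, -, -, τ, hτ, -⟩ := key G₀ hG₀
    refine ⟨τ, ⟨φ, hφ, hτ⟩, fun G A hG hA => ?_⟩
    obtain ⟨p, f, hf, τ', hτ', hp⟩ := key G hG
    obtain rfl := tendsto_nhds_unique hτ hτ'
    obtain ⟨C, hC, hCE⟩ := exists_complexity_le_mul_homSeries hsat hft hG
    obtain ⟨c, hc⟩ := hA.exists_neg_le_phiPlus G
    obtain ⟨c', hc'⟩ := hA.exists_weight_phiPlus_le hG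
    refine tendsto_div_of_le_of_slope (c := c)
      (a := fun t n => Real.log (homSeries k t G (F.obj^[n] G)).toReal)
      (fun t _ => hφ' G hG t) hτ hp (fun n => ?_)
      (fun t ht => ⟨Real.log (C t).toReal + c' * t, fun n => ?_⟩)
    · exact_mod_cast hc _ _ (f n) (hf n)
    · rw [mul_comm]
      exact mul_le_log_homSeries_add (hC t) (hCE t _) (hnt G t n)
        (hc' t ht _ (hF.not_isZero_iterate hft hG n))
  · rintro ⟨S⟩
    have key : ∀ G : D, IsSplitGenerator G → ∃ (p : ℕ → ℤ) (f : ∀ n, G ⟶ (F.obj^[n] G)⟦p n⟧),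
        (∀ n, f n ≠ 0) ∧ ∃ τ : ℝ, Tendsto (fun t => φ (-t) / t) atTop (𝓝 τ) ∧
          Tendsto (fun n : ℕ => (p n : ℝ) / n) atTop (𝓝 τ) := by
      intro G hG
      choose p f hf hp using fun n =>
        hG.exists_homSeries_le_of_nonpos hft (hF.not_isZero_iterate hft hG n)
      refine ⟨p, f, hf, exists_tendsto_slope (h := fun t => φ (-t))
        (a := fun t n => Real.log (homSeries k (-t) G (F.obj^[n] G)).toReal)
        (fun t _ => hφ' G hG (-t)) (fun t _ n => ?_) (fun t ht n => ?_)⟩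
      · have := hle (t := -t) (hf n)
        linarith
      · have := hge hG (hp n (-t) (by linarith))
        simp only [neg_zero]
        linarith
    obtain ⟨G₀, hG₀⟩ := hgen
    obtain ⟨-, -, -, τ, hτ, -⟩ := key G₀ hG₀
    refine ⟨-τ, ⟨φ, hφ, ?_⟩, fun G A hG hA => ?_⟩
    · refine ((hτ.comp tendsto_neg_atBot_atTop).neg).congr fun t => ?_
      simp [div_neg]
    obtain ⟨p, f, hf, τ', hτ', hp⟩ := key G hG
    obtain rfl := tendsto_nhds_unique hτ hτ'
    obtain ⟨C, hC, hCE⟩ := exists_complexity_le_mul_homSeries hsat hft hG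
    obtain ⟨c, hc⟩ := hA.exists_phiMinus_le_of_serreFunctor S G
    obtain ⟨c', hc'⟩ := hA.exists_weight_phiMinus_le hG
    have hy := tendsto_div_of_le_of_slope (c := c) (h := fun t => φ (-t))
      (y := fun n => -(phiMinus A (F.obj^[n] G) : ℝ))
      (a := fun t n => Real.log (homSeries k (-t) G (F.obj^[n] G)).toReal)
      (fun t _ => hφ' G hG (-t)) hτ hp (fun n => ?_)
      (fun t ht => ⟨Real.log (C (-t)).toReal + c' * (-t), fun n => ?_⟩)
    · refine hy.neg.congr fun n => ?_
      rw [neg_div, neg_neg]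
    · have : (phiMinus A (F.obj^[n] G) : ℝ) ≤ -p n + c := by exact_mod_cast hc _ _ (f n) (hf n)
      linarith
    · have := mul_le_log_homSeries_add (hC (-t)) (hCE (-t) _) (hnt G (-t) n)
        (hc' (-t) (by linarith) _ (hF.not_isZero_iterate hft hG n))
      linarith
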